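/- Online portfolio selection. There are $N\ge 1$ stocks and a known horizon of $T>N$ rounds. In round $t=1,\dots,T$ the learner chooses $x_t\in\Delta_N=\{x\in\mathbb R^N: x_i\ge 0,\ \sum_i x_i=1\}$, and then observes a price relative vector $r_t\in\mathbb R_{\ge 0}^N\setminus\{0\}$, chosen arbitrarily by an adversary. The loss is $f_t(x)=-\ln\langle x,r_t\rangle\in(-\infty,+\infty]$, and for $u\in\Delta_N$ the regret is $\mathrm{Reg}(u)=\sum_{t=1}^T f_t(x_t)-\sum_{t=1}^T f_t(u)\in[-\infty,+\infty]$. Let $\bar\Delta_N=\{x\in\Delta_N: x_i\ge \frac1{NT}\ \forall i\}$. BARRONS with parameters $\beta,\eta>0$ starts at $x_1=(\frac1N,\dots,\frac1N)$. With $\nabla_s=\nabla f_s(x_s)=-r_s/\langle x_s,r_s\rangle$, it puts $$A_t=N I_N+\sum_{s\le t}\nabla_s\nabla_s^\top,\qquad \eta_{t,i}=\eta\exp\Big(\max_{s\le t}\log_T\tfrac1{N x_{s,i}}\Big),\qquad \psi_t(x)=\tfrac\beta2x^\top A_t x+\sum_{i=1}^N\tfrac1{\eta_{t,i}}\ln\tfrac1{x_i},$$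 and plays $x_{t+1}=\operatorname{argmin}_{x\in\bar\Delta_N}\ \langle x,\nabla_t\rangle+D_{\psi_t}(x,x_t)$, where $D_\psi(x,y)=\psi(x)-\psi(y)-\langle\nabla\psi(y),x-y\rangle$. Ada-BARRONS sets $\beta=\frac12$, $\eta=\frac1{2048N(\ln T)^2}$, $\gamma=\frac1{25}$ and runs BARRONS with parameters $\beta,\eta$. After each round $t$ it computes $$u_t=\operatorname{argmin}_{u\in\bar\Delta_N}\ \sum_{s=1}^t f_s(u)+\frac1\gamma\sum_{i=1}^N\ln\frac1{u_i}.$$ If $\beta>\alpha_t(u_t)$, where $\alpha_t(u)=\min\big\{\frac12,\ \min_{s\le t}\frac1{8|(u-x_s)^\top\nabla_s|}\big\}$ with $\frac10=+\infty$, then $\beta$ is replaced by $\beta/2$ and BARRONS is rerun from scratch with the new $\beta$ in the following rounds. The time index is then reset to $1$ and all previous data are forgotten, so that $x_s,r_s,\nabla_s,u_t,\alpha_t$ refer to the current run only; $T$ and $\eta$ are unchanged. Theorem. There is an absolute constant $C>0$ such that for all $N\ge1$, all $T>N$, all such sequences $r_1,\dots,r_T$ and all $u\in\Delta_N$, the plays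 of Ada-BARRONS satisfy $$\mathrm{Reg}(u)\le C\,N^2(\ln T)^4 .$$ In particular, the bound does not depend on the largest gradient norm $G=\max_{t\in[T]}\|\nabla f_t(x_t)\|_\infty$. -/

import Mathlib

open scoped ENNReal Matrix

noncomputable section

namespace AdaBarrons

/-! Rounds are numbered from `0`, so that "round `t`" below is round `t + 1` when counting from `1`,
and the rounds up to and including round `t` are those in `Finset.range (t + 1)`.
`x ⬝ᵥ y` is the inner product of `x, y : Fin N → ℝ`. -/

/-- The loss `f(x) = -ln ⟨x, r⟩` of the portfolio `x` at the price relative vector `r`, as a real number.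
It is used only for portfolios with all coordinates positive, for which `⟨x, r⟩ > 0`. -/
def loss {N : ℕ} (r x : Fin N → ℝ) : ℝ := -Real.log (x ⬝ᵥ r)

/-- The loss `f(x) = -ln ⟨x, r⟩` with values in the extended reals: it is `+∞` if `⟨x, r⟩ = 0`. -/
def extLoss {N : ℕ} (r x : Fin N → ℝ) : EReal := -ENNReal.log (ENNReal.ofReal (x ⬝ᵥ r))

theorem extLoss_eq_loss {N : ℕ} {r x : Fin N → ℝ} (h : 0 < x ⬝ᵥ r) :
    extLoss r x = (loss r x : EReal) := by
  rw [extLoss, loss, ENNReal.log_ofReal_of_pos h, EReal.coe_neg]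

theorem extLoss_eq_top {N : ℕ} {r x : Fin N → ℝ} (h : x ⬝ᵥ r = 0) : extLoss r x = ⊤ := by
  simp [extLoss, h]

/-- The regret over `T` rounds of the plays `x` against the constant-rebalanced portfolio `u`. -/
def regret {N : ℕ} (T : ℕ) (r x : ℕ → Fin N → ℝ) (u : Fin N → ℝ) : EReal :=
  (∑ t ∈ Finset.range T, extLoss (r t) (x t)) - (∑ t ∈ Finset.range T, extLoss (r t) u)

/-- The gradient `-r / ⟨x, r⟩` of `loss r` at `x`. -/
def lossGrad {N : ℕ} (r x : Fin N → ℝ) : Fin N → ℝ := fun i => -r i / (x ⬝ᵥ r)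

theorem hasFDerivAt_loss {N : ℕ} {r x : Fin N → ℝ} (h : 0 < x ⬝ᵥ r) :
    HasFDerivAt (loss r) (LinearMap.toContinuousLinearMap (dotProductBilin ℝ ℝ (lossGrad r x))) x := by
  have h1 : HasFDerivAt (fun y : Fin N → ℝ => y ⬝ᵥ r)
      (LinearMap.toContinuousLinearMap (dotProductBilin ℝ ℝ r)) x := by
    have := (LinearMap.toContinuousLinearMap (dotProductBilin ℝ ℝ r)).hasFDerivAt (x := x)
    refine this.congr_of_eventuallyEq (Filter.Eventually.of_forall fun y => ?_)
    simp [dotProductBilin, dotProduct_comm]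
  refine ((h1.log h.ne').neg).congr_fderiv ?_
  ext v
  simp [dotProductBilin, lossGrad, dotProduct, div_eq_inv_mul, Finset.mul_sum, mul_assoc]

/-- A minimizer of `F` over `S`. When Ada-BARRONS is run with `0 < N < T` on nonnegative nonzero price
relative vectors, `S` is always a nonempty compact convex set on which `F` is continuous and strictly
convex, so that the minimizer exists and is unique. -/
def argmin {N : ℕ} (S : Set (Fin N → ℝ)) (F : (Fin N → ℝ) → ℝ) : Fin N → ℝ :=
  Classical.epsilon fun x => x ∈ S ∧ IsMinOn F S x

/-- The Bregman divergence `D_ψ(x, y) = ψ(x) - ψ(y) - ⟨∇ψ(y), x - y⟩`. -/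
def bregman {N : ℕ} (ψ : (Fin N → ℝ) → ℝ) (x y : Fin N → ℝ) : ℝ :=
  ψ x - ψ y - fderiv ℝ ψ y (x - y)

/-- The truncated simplex `{x ∈ Δ_N : x_i ≥ 1 / (N T) for all i}`. -/
def truncSimplex (N T : ℕ) : Set (Fin N → ℝ) :=
  {x | x ∈ stdSimplex ℝ (Fin N) ∧ ∀ i, 1 / ((N : ℝ) * T) ≤ x i}

/-- The matrix `A_t = N I + ∑_{s ≤ t} ∇_s ∇_sᵀ`, where `∇_s = ∇f_s(x_s)`. -/
def covMatrix {N : ℕ} (r x : ℕ → Fin N → ℝ) (t : ℕ) : Matrix (Fin N) (Fin N) ℝ :=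
  (N : ℝ) • (1 : Matrix (Fin N) (Fin N) ℝ) +
    ∑ s ∈ Finset.range (t + 1), Matrix.vecMulVec (lossGrad (r s) (x s)) (lossGrad (r s) (x s))

/-- The learning rate `η_{t,i} = η exp (max_{s ≤ t} log_T (1 / (N x_{s,i})))`. -/
def learningRate {N : ℕ} (T : ℕ) (η : ℝ) (x : ℕ → Fin N → ℝ) (t : ℕ) (i : Fin N) : ℝ :=
  η * Real.exp ((Finset.range (t + 1)).sup' Finset.nonempty_range_add_one
    fun s => Real.logb T (1 / (N * x s i)))

/-- The regularizer `ψ_t(y) = (β / 2) yᵀ A_t y + ∑ i, (1 / η_{t,i}) ln (1 / y_i)`. -/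
def regularizer {N : ℕ} (T : ℕ) (β η : ℝ) (r x : ℕ → Fin N → ℝ) (t : ℕ) (y : Fin N → ℝ) : ℝ :=
  β / 2 * (y ⬝ᵥ (covMatrix r x t *ᵥ y)) +
    ∑ i, 1 / learningRate T η x t i * Real.log (1 / y i)

/-- The function `y ↦ ⟨y, ∇_t⟩ + D_{ψ_t}(y, x_t)` that is minimized to obtain `x_{t+1}`. -/
def omdObjective {N : ℕ} (T : ℕ) (β η : ℝ) (r x : ℕ → Fin N → ℝ) (t : ℕ) (y : Fin N → ℝ) : ℝ :=
  y ⬝ᵥ lossGrad (r t) (x t) + bregman (regularizer T β η r x t) y (x t)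

/-- The plays of BARRONS with horizon parameter `T` and parameters `β, η` on the price relative vectors
`r`. The play `t + 1` depends on `r s` and on the plays `s` with `s ≤ t` only (the value `0` given
to the later plays inside the definition is never used, see `barrons_succ`). -/
def barrons {N : ℕ} (T : ℕ) (β η : ℝ) (r : ℕ → Fin N → ℝ) : ℕ → Fin N → ℝ
  | 0 => fun _ => 1 / (N : ℝ)
  | t + 1 => argmin (truncSimplex N T)
      (omdObjective T β η r (fun s => if _h : s ≤ t then barrons T β η r s else 0) t)
  decreasing_by omega

theorem omdObjective_congr {N : ℕ} (T : ℕ) (β η : ℝ) {r r' x x' : ℕ → Fin N → ℝ} {t : ℕ}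
    (hr : ∀ s ≤ t, r s = r' s) (hx : ∀ s ≤ t, x s = x' s) :
    omdObjective T β η r x t = omdObjective T β η r' x' t := by
  have hA : covMatrix r x t = covMatrix r' x' t := by
    unfold covMatrix
    congr 1
    refine Finset.sum_congr rfl fun s hs => ?_
    have hs' : s ≤ t := by simpa [Nat.lt_succ_iff] using hs
    rw [hr s hs', hx s hs']
  have hη : ∀ i, learningRate T η x t i = learningRate T η x' t i := by
    intro i
    unfold learningRate
    congr 2
    refine Finset.sup'_congr _ rfl fun s hs => ?_
    have hs' : s ≤ t := by simpa [Nat.lt_succ_iff] using hs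
    rw [hx s hs']
  have hψ : regularizer T β η r x t = regularizer T β η r' x' t := by
    funext y
    simp only [regularizer, hA, hη]
  funext y
  simp only [omdObjective, hψ, hr t le_rfl, hx t le_rfl]

theorem barrons_zero {N : ℕ} (T : ℕ) (β η : ℝ) (r : ℕ → Fin N → ℝ) :
    barrons T β η r 0 = fun _ => 1 / (N : ℝ) := by
  rw [barrons]

theorem barrons_succ {N : ℕ} (T : ℕ) (β η : ℝ) (r : ℕ → Fin N → ℝ) (t : ℕ) :
    barrons T β η r (t + 1) =
      argmin (truncSimplex N T) (omdObjective T β η r (barrons T β η r) t) := by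
  rw [barrons]
  congr 1
  exact omdObjective_congr T β η (fun _ _ => rfl) fun s hs => by simp [hs]

/-- `α_t(u) = min {1/2, min_{s ≤ t} 1 / (8 |(u - x_s)ᵀ ∇_s|)}`, where `1 / 0 = ∞`. -/
def alpha {N : ℕ} (r x : ℕ → Fin N → ℝ) (t : ℕ) (u : Fin N → ℝ) : ℝ≥0∞ :=
  min (1 / 2) (⨅ s ∈ Finset.range (t + 1),
    1 / ENNReal.ofReal (8 * |(u - x s) ⬝ᵥ lossGrad (r s) (x s)|))

/-- The regularized leader
`u_t = argmin_{u} ∑_{s ≤ t} f_s(u) + (1 / γ) ∑ i, ln (1 / u_i)` over the truncated simplex. -/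
def regLeader {N : ℕ} (T : ℕ) (γ : ℝ) (r : ℕ → Fin N → ℝ) (t : ℕ) : Fin N → ℝ :=
  argmin (truncSimplex N T) fun u =>
    (∑ s ∈ Finset.range (t + 1), loss (r s) u) + 1 / γ * ∑ i, Real.log (1 / u i)

/-- The parameter `η = 1 / (2048 N (ln T)²)` of Ada-BARRONS. -/
def adaEta (N T : ℕ) : ℝ := 1 / (2048 * N * Real.log T ^ 2)

/-- The parameter `γ = 1 / 25` of Ada-BARRONS. -/
def adaGamma : ℝ := 1 / 25

/-- The state of Ada-BARRONS before a round: the current value of `β`, the global index `start` of the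
first round of the current epoch, and the index `round` of the round within the current epoch;
the global index of the round is `start + round`. -/
structure AdaState where
  /-- current `β` -/
  β : ℝ
  /-- global index of the first round of the current epoch -/
  start : ℕ
  /-- index within the current epoch -/
  round : ℕ

/-- The price relative vectors of the current epoch, with the time index reset at its start. -/
def AdaState.epochPrices {N : ℕ} (S : AdaState) (r : ℕ → Fin N → ℝ) : ℕ → Fin N → ℝ :=
  fun s => r (S.start + s)

/-- The plays in the current epoch: BARRONS run on the data of the epoch only. -/
def AdaState.epochPlays {N : ℕ} (S : AdaState) (T : ℕ) (r : ℕ → Fin N → ℝ) : ℕ → Fin N → ℝ :=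
  barrons T S.β (adaEta N T) (S.epochPrices r)

/-- The restart condition `β > α_t(u_t)`, checked at the end of the round. -/
def AdaState.Restarts {N : ℕ} (S : AdaState) (T : ℕ) (r : ℕ → Fin N → ℝ) : Prop :=
  alpha (S.epochPrices r) (S.epochPlays T r) S.round
    (regLeader T adaGamma (S.epochPrices r) S.round) < ENNReal.ofReal S.β

open Classical in
/-- The state of Ada-BARRONS before round `t`. -/
def adaState {N : ℕ} (T : ℕ) (r : ℕ → Fin N → ℝ) : ℕ → AdaState
  | 0 => ⟨1 / 2, 0, 0⟩
  | t + 1 =>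
    let S := adaState T r t
    if S.Restarts T r then ⟨S.β / 2, S.start + S.round + 1, 0⟩
    else ⟨S.β, S.start, S.round + 1⟩

/-- The play of Ada-BARRONS in round `t`. -/
def adaBarrons {N : ℕ} (T : ℕ) (r : ℕ → Fin N → ℝ) (t : ℕ) : Fin N → ℝ :=
  (adaState T r t).epochPlays T r (adaState T r t).round

end AdaBarrons

end

namespace AdaBarrons

/-! ### Scalar inequalities -/

/-! Within an epoch the plays are mirror descent iterates with regularizers ψ_t. Put M_s(w) = ⟨w,
r_s⟩ / ⟨x_s, r_s⟩. As long as β M_s(w) ≤ 1, a one-sided condition, the loss difference in round s is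
at most its linearization minus β/2 times the square of that linearization (`log_le_sub_sq`). The
square cancels the growth of A_t in the divergence, and the gradient terms telescope to a
log-determinant, at cost 3 N ln T / β. When x_{s,i} reaches a new minimum, the learning rate of
coordinate i rises and the barrier weight falls, which is a gain (`barrier_change_le`). Altogether
`barrons_regret` bounds regret by O(N² ln³ T) + 3 N ln T / β, minus 360 N ln T times any chosen
ratio w_i / x_{s,i}.

A restart forces such a ratio to be large. The new regularized leader, or a point on the segment
from the previous leader to it, is nearly optimal, satisfies the curvature condition, and has a
ratio of at least 1/(8β) (`exists_comparator`). The gain is then at least 45 N ln T / β, so a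
completed epoch leaves a surplus (`completed_epoch`). As 1/β doubles at each restart, these
surpluses add up to the β-dependent cost of the unfinished epoch, up to 6 N ln T
(`adaState_invariant`). Ratios never exceed NT on the truncated simplex, so 1/β ≤ 16 NT and there
are O(ln T) epochs, each costing O(N² ln³ T). Comparators outside the truncated simplex are mixed
with the uniform portfolio (`exists_trunc_comparator`). -/

theorem log_le_sub_sq {β m : ℝ} (hm : 0 < m) (hβ : β ≤ 1 / 2) (hβm : β * m ≤ 1) :
    Real.log m ≤ (m - 1) - β / 2 * (m - 1) ^ 2 := by
  rcases le_total 1 m with h1 | h1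
  -- With s = ln m, the bound s ≤ sinh s reads ln m ≤ (m - 1/m)/2 = (m - 1) - (m - 1)²/(2m), and β ≤
  -- 1/m.
  · have h := Real.self_le_sinh_iff.2 (Real.log_nonneg h1)
    rw [Real.sinh_eq, Real.exp_neg, Real.exp_log hm] at h
    have h3 : β ≤ 1 / m := by rw [le_div_iff₀ hm]; exact hβm
    have h4 : β / 2 * (m - 1) ^ 2 ≤ 1 / m / 2 * (m - 1) ^ 2 := by gcongr
    have h5 : (m - m⁻¹) / 2 = (m - 1) - 1 / m / 2 * (m - 1) ^ 2 := by field_simp; ring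
    linarith
  -- For m = v² ≤ 1, the bound 2 ln v ≤ 2(v - 1) is strong enough; the slack at β = 1/2 is (v -
  -- 1)²(4 - (v + 1)²)/4.
  · obtain ⟨v, hv, rfl⟩ : ∃ v : ℝ, 0 < v ∧ m = v ^ 2 :=
      ⟨Real.sqrt m, Real.sqrt_pos.2 hm, (Real.sq_sqrt hm.le).symm⟩
    have hv1 : v ≤ 1 := by nlinarith
    have h2 := Real.log_le_sub_one_of_pos hv
    have h4 : β / 2 * (v ^ 2 - 1) ^ 2 ≤ 1 / 4 * (v ^ 2 - 1) ^ 2 :=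
      mul_le_mul_of_nonneg_right (by linarith) (sq_nonneg _)
    have h5 : 0 ≤ (v - 1) ^ 2 * (4 - (v + 1) ^ 2) :=
      mul_nonneg (sq_nonneg _) (by nlinarith)
    rw [Real.log_pow]
    push_cast
    nlinarith

theorem sub_one_sub_log_nonneg {y : ℝ} (hy : 0 < y) : 0 ≤ y - 1 - Real.log y := by
  linarith [Real.log_le_sub_one_of_pos hy]

/-- The tangent of ln at 4 gives ln y ≤ y/4 - 1 + 2 ln 2, and 2 ln 2 < 6/4. This is the origin of
the threshold 6 in the potential `max · 6`: above it the barrier term is comparable to the ratio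
itself. -/
theorem half_le_sub_one_sub_log {y : ℝ} (hy : 6 ≤ y) : y / 2 ≤ y - 1 - Real.log y := by
  have h := Real.log_le_sub_one_of_pos (show 0 < y / 4 by linarith)
  have h4 : Real.log 4 = 2 * Real.log 2 := by
    rw [show (4 : ℝ) = 2 ^ 2 by norm_num, Real.log_pow]; norm_num
  rw [Real.log_div (by linarith) (by norm_num), h4] at h
  linarith [Real.log_two_lt_d9]

/-- The change of a barrier term `(1 / η_t) (w / x - 1 - ln (w / x))` when the exponent of the learning
rate grows from `g` to `max g (log_T (1 / (N x)))`. -/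
theorem barrier_change_le {L η g l y : ℝ} (hL : 0 < L) (hη : 0 < η) (hl1 : l ≤ 1)
    (K : ℝ) (hy : 0 < y) (hyK : y = K * Real.exp (l * L)) :
    (1 / (η * Real.exp (max g l)) - 1 / (η * Real.exp g)) * (y - 1 - Real.log y) ≤
      -(1 / (2 * Real.exp 1 * η * L)) *
        (max (K * Real.exp (max g l * L)) 6 - max (K * Real.exp (g * L)) 6) := by
  rcases le_total l g with h | h
  · simp [max_eq_left h]
  rw [max_eq_right h, ← hyK]
  set y₀ := K * Real.exp (g * L) with hy₀
  have hK : 0 < K := by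
    by_contra hK
    have := mul_nonpos_of_nonpos_of_nonneg (not_lt.1 hK) (Real.exp_pos (l * L)).le
    linarith
  -- Since l ≤ 1, the learning rate never exceeds eη, so the drop in barrier weight is at least
  -- linear in l - g.
  have hc : (1 / (η * Real.exp l) - 1 / (η * Real.exp g)) ≤ -((l - g) / (η * Real.exp 1)) := by
    have h1 : 1 / (η * Real.exp g) = 1 / (η * Real.exp l) * Real.exp (l - g) := by
      rw [Real.exp_sub]; field_simp
    have h2 : 1 + (l - g) ≤ Real.exp (l - g) := by linarith [Real.add_one_le_exp (l - g)]
    have h3 : 1 / (η * Real.exp 1) ≤ 1 / (η * Real.exp l) := by gcongr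
    have h4 : 0 < 1 / (η * Real.exp 1) := by positivity
    rw [h1, show (l - g) / (η * Real.exp 1) = 1 / (η * Real.exp 1) * (l - g) by ring]
    nlinarith
  have hyy : y - y₀ ≤ y * ((l - g) * L) := by
    have h1 : y₀ = y * Real.exp (-((l - g) * L)) := by
      rw [hyK, hy₀, mul_assoc, ← Real.exp_add]; ring_nf
    have h2 := Real.add_one_le_exp (-((l - g) * L))
    rw [h1]
    nlinarith
  have hh := sub_one_sub_log_nonneg hy
  have h0 : 0 ≤ (l - g) / (η * Real.exp 1) := div_nonneg (by linarith) (by positivity)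
  have hcc : 0 < 1 / (2 * Real.exp 1 * η * L) := by positivity
  have hle : max y 6 - max y₀ 6 ≤ 2 * (l - g) * L * (y - 1 - Real.log y) := by
    rcases le_total y 6 with h6 | h6
    · rw [max_eq_right h6]
      have : 0 ≤ 2 * (l - g) * L * (y - 1 - Real.log y) := by
        have : 0 ≤ l - g := by linarith
        positivity
      linarith [le_max_right y₀ 6]
    · rw [max_eq_left h6]
      have h7 := half_le_sub_one_sub_log h6
      have h8 : 0 ≤ (l - g) * L := mul_nonneg (by linarith) hL.le
      nlinarith [le_max_left y₀ 6]
  calc _ ≤ -((l - g) / (η * Real.exp 1)) * (y - 1 - Real.log y) := by gcongr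
    _ = -(1 / (2 * Real.exp 1 * η * L)) * (2 * (l - g) * L * (y - 1 - Real.log y)) := by
      field_simp
    _ ≤ _ := by nlinarith

/-! ### Linear algebra -/

theorem dotProduct_mulVec_symm {n : Type*} [Fintype n] {A : Matrix n n ℝ} (hA : Aᵀ = A)
    (u v : n → ℝ) : u ⬝ᵥ (A *ᵥ v) = v ⬝ᵥ (A *ᵥ u) := by
  rw [Matrix.dotProduct_mulVec, ← Matrix.mulVec_transpose, hA, dotProduct_comm]

theorem vecMulVec_quadForm {n : Type*} [Fintype n] (g d : n → ℝ) :
    d ⬝ᵥ (Matrix.vecMulVec g g *ᵥ d) = (g ⬝ᵥ d) ^ 2 := by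
  rw [Matrix.vecMulVec_mulVec]
  simp [dotProduct_comm d g, sq]

theorem posSemidef_quadForm_nonneg {n : Type*} [Fintype n] {A : Matrix n n ℝ} (hA : A.PosSemidef)
    (d : n → ℝ) : 0 ≤ d ⬝ᵥ (A *ᵥ d) := by
  simpa using hA.dotProduct_mulVec_nonneg d

/-- Young's inequality for the norm of a positive definite matrix and its dual norm. -/
theorem dotProduct_le_quadForm {n : Type*} [Fintype n] [DecidableEq n] {A : Matrix n n ℝ}
    (hA : A.PosDef) {β : ℝ} (hβ : 0 < β) (g d : n → ℝ) :
    g ⬝ᵥ d ≤ 1 / (2 * β) * (g ⬝ᵥ (A⁻¹ *ᵥ g)) + β / 2 * (d ⬝ᵥ (A *ᵥ d)) := by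
  have hsymm : Aᵀ = A := (Matrix.conjTranspose_eq_transpose_of_trivial A).symm.trans hA.isHermitian
  have hdet : IsUnit A.det := hA.det_pos.ne'.isUnit
  set p := A⁻¹ *ᵥ g with hp
  have hAp : A *ᵥ p = g := by
    rw [hp, Matrix.mulVec_mulVec, Matrix.mul_nonsing_inv _ hdet, Matrix.one_mulVec]
  have h := posSemidef_quadForm_nonneg hA.posSemidef (β • d - p)
  rw [Matrix.mulVec_sub, Matrix.mulVec_smul, hAp] at h
  simp only [sub_dotProduct, dotProduct_sub, smul_dotProduct, dotProduct_smul, smul_eq_mul] at h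
  rw [dotProduct_mulVec_symm hsymm p d, hAp, dotProduct_comm d g, dotProduct_comm p g] at h
  have h2 : 1 / (2 * β) * (g ⬝ᵥ p) + β / 2 * (d ⬝ᵥ (A *ᵥ d)) - g ⬝ᵥ d =
      1 / (2 * β) * (β * (β * (d ⬝ᵥ (A *ᵥ d))) - β * (g ⬝ᵥ d) - (β * (g ⬝ᵥ d) - g ⬝ᵥ p)) := by
    field_simp; ring
  have h3 : 0 ≤ 1 / (2 * β) * (β * (β * (d ⬝ᵥ (A *ᵥ d))) - β * (g ⬝ᵥ d) -
      (β * (g ⬝ᵥ d) - g ⬝ᵥ p)) := mul_nonneg (by positivity) (by linarith)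
  linarith

/-- With B = A + g gᵀ and q = gᵀ B⁻¹ g, the matrix determinant lemma gives det A = det B · (1 - q),
and ln(1 - q) ≤ -q. Summed over rounds, the right side telescopes. -/
theorem dotProduct_inv_mulVec_le_log_det {n : Type*} [Fintype n] [DecidableEq n]
    {A : Matrix n n ℝ} (hA : A.PosDef) (g : n → ℝ) :
    g ⬝ᵥ ((A + Matrix.vecMulVec g g)⁻¹ *ᵥ g) ≤
      Real.log (A + Matrix.vecMulVec g g).det - Real.log A.det := by
  have hB : (A + Matrix.vecMulVec g g).PosDef := by
    have := Matrix.posSemidef_vecMulVec_self_star g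
    exact hA.add_posSemidef (by simpa using this)
  set B := A + Matrix.vecMulVec g g with hBdef
  have h := Matrix.det_add_replicateCol_mul_replicateRow (ι := Unit) (A := B)
    hB.det_pos.ne'.isUnit (-g) g
  have h1 : B + Matrix.replicateCol Unit (-g) * Matrix.replicateRow Unit g = A := by
    rw [← Matrix.vecMulVec_eq, hBdef, Matrix.neg_vecMulVec]; abel
  have h2 : (1 + Matrix.replicateRow Unit g * B⁻¹ * Matrix.replicateCol Unit (-g)).det =
      1 - g ⬝ᵥ (B⁻¹ *ᵥ g) := by
    rw [Matrix.det_unique, Matrix.mul_assoc, ← Matrix.replicateCol_mulVec]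
    simp [Matrix.mul_apply, Matrix.mulVec_neg, dotProduct, sub_eq_add_neg]
  rw [h1, h2] at h
  have hq : 0 < 1 - g ⬝ᵥ (B⁻¹ *ᵥ g) :=
    (mul_pos_iff_of_pos_left hB.det_pos).1 (h ▸ hA.det_pos)
  rw [h, Real.log_mul hB.det_pos.ne' hq.ne']
  linarith [Real.log_le_sub_one_of_pos hq]

theorem posSemidef_det_le_trace_pow {n : Type*} [Fintype n] [DecidableEq n] {A : Matrix n n ℝ}
    (hA : A.PosSemidef) : A.det ≤ A.trace ^ Fintype.card n := by
  have hs : A.trace = ∑ i, hA.isHermitian.eigenvalues i := by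
    simpa using hA.isHermitian.trace_eq_sum_eigenvalues
  have hd : A.det = ∏ i, hA.isHermitian.eigenvalues i := by
    simpa using hA.isHermitian.det_eq_prod_eigenvalues
  rw [hd, ← Finset.card_univ]
  rw [← Finset.prod_const]
  refine Finset.prod_le_prod (fun i _ => hA.eigenvalues_nonneg i) fun i _ => ?_
  rw [hs]
  exact Finset.single_le_sum (fun j _ => hA.eigenvalues_nonneg j) (Finset.mem_univ i)

/-! ### Minimizers over the truncated simplex -/

theorem argmin_spec {N : ℕ} {S : Set (Fin N → ℝ)} {F : (Fin N → ℝ) → ℝ} (hS : IsCompact S)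
    (hne : S.Nonempty) (hF : ContinuousOn F S) : argmin S F ∈ S ∧ IsMinOn F S (argmin S F) :=
  Classical.epsilon_spec (p := fun x => x ∈ S ∧ IsMinOn F S x) (hS.exists_isMinOn hne hF)

theorem isCompact_truncSimplex (N T : ℕ) : IsCompact (truncSimplex N T) := by
  have h : truncSimplex N T = stdSimplex ℝ (Fin N) ∩ ⋂ i, {x | 1 / ((N : ℝ) * T) ≤ x i} := by
    ext x; simp [truncSimplex]
  rw [h]
  exact (isCompact_stdSimplex ℝ (Fin N)).inter_right
    (isClosed_iInter fun i => isClosed_le continuous_const (continuous_apply i))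

theorem convex_truncSimplex (N T : ℕ) : Convex ℝ (truncSimplex N T) := by
  intro x hx y hy a b ha hb hab
  refine ⟨convex_stdSimplex ℝ (Fin N) hx.1 hy.1 ha hb hab, fun i => ?_⟩
  have h1 := mul_le_mul_of_nonneg_left (hx.2 i) ha
  have h2 := mul_le_mul_of_nonneg_left (hy.2 i) hb
  simp only [Pi.add_apply, Pi.smul_apply, smul_eq_mul]
  calc 1 / ((N : ℝ) * T) = a * (1 / (N * T)) + b * (1 / (N * T)) := by rw [← add_mul, hab, one_mul]
    _ ≤ _ := by linarith

section

variable {N T : ℕ}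

theorem uniform_mem_truncSimplex (hN : 0 < N) (hT : 0 < T) :
    (fun _ => 1 / (N : ℝ)) ∈ truncSimplex N T := by
  have hN' : (0 : ℝ) < N := by exact_mod_cast hN
  have hT' : (1 : ℝ) ≤ T := by exact_mod_cast hT
  refine ⟨⟨fun i => by positivity, ?_⟩, fun i => ?_⟩
  · simp [hN'.ne']
  · exact one_div_le_one_div_of_le hN' (by nlinarith)

theorem truncSimplex_pos (hN : 0 < N) (hT : 0 < T) {x : Fin N → ℝ} (hx : x ∈ truncSimplex N T)
    (i : Fin N) : 0 < x i := by
  have hN' : (0 : ℝ) < N := by exact_mod_cast hN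
  have hT' : (0 : ℝ) < T := by exact_mod_cast hT
  exact lt_of_lt_of_le (by positivity) (hx.2 i)

theorem truncSimplex_le_one {x : Fin N → ℝ} (hx : x ∈ truncSimplex N T) (i : Fin N) : x i ≤ 1 := by
  rw [← hx.1.2]
  exact Finset.single_le_sum (fun j _ => hx.1.1 j) (Finset.mem_univ i)

/-! ### The regularizer -/

/-- The sum of a quadratic form and a weighted logarithmic barrier. -/
noncomputable def quadLog (β : ℝ) (A : Matrix (Fin N) (Fin N) ℝ) (c y : Fin N → ℝ) : ℝ :=
  β / 2 * (y ⬝ᵥ (A *ᵥ y)) + ∑ i, c i * Real.log (1 / y i)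

/-- The explicit form of the Bregman divergence of `quadLog`. -/
noncomputable def quadLogDiv (β : ℝ) (A : Matrix (Fin N) (Fin N) ℝ) (c u y : Fin N → ℝ) : ℝ :=
  β / 2 * ((u - y) ⬝ᵥ (A *ᵥ (u - y))) + ∑ i, c i * (u i / y i - 1 - Real.log (u i / y i))

theorem differentiableAt_quadLog (β : ℝ) (A : Matrix (Fin N) (Fin N) ℝ) (c : Fin N → ℝ)
    {y : Fin N → ℝ} (hy : ∀ i, 0 < y i) : DifferentiableAt ℝ (quadLog β A c) y := by
  unfold quadLog
  simp only [dotProduct, Matrix.mulVec, one_div, Real.log_inv]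
  refine DifferentiableAt.add (by fun_prop) ?_
  refine DifferentiableAt.fun_sum fun i _ => ?_
  have h : DifferentiableAt ℝ (fun z : Fin N → ℝ => z i) y := by fun_prop
  exact ((h.log (hy i).ne').neg).const_mul _

theorem fderiv_quadLog {β : ℝ} {A : Matrix (Fin N) (Fin N) ℝ} (hA : Aᵀ = A) {c y : Fin N → ℝ}
    (hy : ∀ i, 0 < y i) (v : Fin N → ℝ) :
    fderiv ℝ (quadLog β A c) y v = β * (v ⬝ᵥ (A *ᵥ y)) - ∑ i, c i * (v i / y i) := by
  rw [← (differentiableAt_quadLog β A c hy).lineDeriv_eq_fderiv]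
  refine HasLineDerivAt.lineDeriv ?_
  unfold HasLineDerivAt
  have hq : HasDerivAt (fun t : ℝ => β / 2 * (y ⬝ᵥ (A *ᵥ y) + t * (2 * (v ⬝ᵥ (A *ᵥ y))) +
      t ^ 2 * (v ⬝ᵥ (A *ᵥ v)))) (β * (v ⬝ᵥ (A *ᵥ y))) 0 := by
    have h1 := (((hasDerivAt_id (0 : ℝ)).mul_const (2 * (v ⬝ᵥ (A *ᵥ y)))).const_add
      (y ⬝ᵥ (A *ᵥ y))).add (((hasDerivAt_id (0 : ℝ)).pow 2).mul_const (v ⬝ᵥ (A *ᵥ v)))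
    refine (h1.const_mul (β / 2)).congr_deriv ?_
    simp; ring
  have hl : HasDerivAt (fun t : ℝ => ∑ i, c i * Real.log (1 / (y i + t * v i)))
      (- ∑ i, c i * (v i / y i)) 0 := by
    rw [← Finset.sum_neg_distrib]
    refine HasDerivAt.fun_sum fun i _ => ?_
    have h1 : HasDerivAt (fun t : ℝ => y i + t * v i) (v i) 0 := by
      simpa using ((hasDerivAt_id (0 : ℝ)).mul_const (v i)).const_add (y i)
    have h2 := ((h1.log (by simpa using (hy i).ne')).neg).const_mul (c i)
    simp only [one_div, Real.log_inv]
    refine h2.congr_deriv ?_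
    simp
  refine ((hq.add hl).congr_of_eventuallyEq (Filter.Eventually.of_forall fun t => ?_)).congr_deriv
    (by ring)
  simp only [quadLog, Pi.add_apply, Pi.smul_apply, smul_eq_mul, Matrix.mulVec_add,
    Matrix.mulVec_smul, add_dotProduct, dotProduct_add, smul_dotProduct, dotProduct_smul]
  rw [dotProduct_mulVec_symm hA y v]
  ring

theorem bregman_quadLog {β : ℝ} {A : Matrix (Fin N) (Fin N) ℝ} (hA : Aᵀ = A) {c u y : Fin N → ℝ}
    (hu : ∀ i, 0 < u i) (hy : ∀ i, 0 < y i) :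
    bregman (quadLog β A c) u y = quadLogDiv β A c u y := by
  have hs : ∑ i, c i * Real.log (1 / u i) - ∑ i, c i * Real.log (1 / y i) +
      ∑ i, c i * ((u - y) i / y i) = ∑ i, c i * (u i / y i - 1 - Real.log (u i / y i)) := by
    rw [← Finset.sum_sub_distrib, ← Finset.sum_add_distrib]
    refine Finset.sum_congr rfl fun i _ => ?_
    rw [Real.log_div (hu i).ne' (hy i).ne', one_div, one_div, Real.log_inv, Real.log_inv,
      Pi.sub_apply, sub_div, div_self (hy i).ne']
    ring
  rw [bregman, fderiv_quadLog hA hy, quadLogDiv, ← hs, quadLog, quadLog]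
  simp only [Matrix.mulVec_sub, sub_dotProduct, dotProduct_sub]
  rw [dotProduct_mulVec_symm hA y u]
  ring

/-- The three-point identity of the Bregman divergence. -/
theorem quadLogDiv_three_point {β : ℝ} {A : Matrix (Fin N) (Fin N) ℝ} (hA : Aᵀ = A)
    {c u x x' : Fin N → ℝ} (hu : ∀ i, 0 < u i) (hx : ∀ i, 0 < x i) (hx' : ∀ i, 0 < x' i) :
    fderiv ℝ (quadLog β A c) x' (u - x') - fderiv ℝ (quadLog β A c) x (u - x') =
      quadLogDiv β A c u x - quadLogDiv β A c u x' - quadLogDiv β A c x' x := by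
  rw [← bregman_quadLog hA hu hx, ← bregman_quadLog hA hu hx', ← bregman_quadLog hA hx' hx]
  simp only [bregman, map_sub]
  ring

theorem fderiv_nonneg_of_isMinOn {E : Type*} [NormedAddCommGroup E] [NormedSpace ℝ E] {S : Set E}
    (hS : Convex ℝ S) {F : E → ℝ} {x w : E} (hx : x ∈ S) (hw : w ∈ S) (hmin : IsMinOn F S x)
    (hF : DifferentiableAt ℝ F x) : 0 ≤ fderiv ℝ F x (w - x) :=
  hmin.localize.hasFDerivWithinAt_nonneg hF.hasFDerivAt.hasFDerivWithinAt
    (sub_mem_posTangentConeAt_of_segment_subset (hS.segment_subset hx hw))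

/-- One step of online mirror descent. -/
theorem omd_step {S : Set (Fin N → ℝ)} (hS : Convex ℝ S) (hpos : ∀ x ∈ S, ∀ i, 0 < x i) {β : ℝ}
    (hβ : 0 < β) {A : Matrix (Fin N) (Fin N) ℝ} (hA : A.PosDef) {c g x x' w : Fin N → ℝ}
    (hc : ∀ i, 0 ≤ c i) (hx : x ∈ S) (hx' : x' ∈ S) (hw : w ∈ S)
    (hmin : IsMinOn (fun y => y ⬝ᵥ g + bregman (quadLog β A c) y x) S x') :
    g ⬝ᵥ (x - w) ≤ 1 / (2 * β) * (g ⬝ᵥ (A⁻¹ *ᵥ g)) +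
      quadLogDiv β A c w x - quadLogDiv β A c w x' := by
  have hsymm : Aᵀ = A := (Matrix.conjTranspose_eq_transpose_of_trivial A).symm.trans hA.isHermitian
  have h3 := quadLogDiv_three_point (β := β) hsymm (c := c) (hpos w hw) (hpos x hx) (hpos x' hx')
  have hlin : HasFDerivAt (fun y : Fin N → ℝ => y ⬝ᵥ g)
      (LinearMap.toContinuousLinearMap (dotProductBilin ℝ ℝ g)) x' := by
    refine (LinearMap.toContinuousLinearMap (dotProductBilin ℝ ℝ g)).hasFDerivAt.congr_of_eventuallyEq
      (Filter.Eventually.of_forall fun y => ?_)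
    simp [dotProductBilin, dotProduct_comm]
  have hψ := (differentiableAt_quadLog β A c (hpos x' hx')).hasFDerivAt
  have hlin2 : HasFDerivAt (fun y => fderiv ℝ (quadLog β A c) x (y - x))
      (fderiv ℝ (quadLog β A c) x) x' :=
    (fderiv ℝ (quadLog β A c) x).hasFDerivAt.comp x' ((hasFDerivAt_id x').sub_const x)
  have hG := hlin.add ((hψ.sub_const (quadLog β A c x)).sub hlin2)
  have hopt := fderiv_nonneg_of_isMinOn hS hx' hw hmin hG.differentiableAt
  have hopt2 : 0 ≤ g ⬝ᵥ (w - x') + (fderiv ℝ (quadLog β A c) x' (w - x') -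
      fderiv ℝ (quadLog β A c) x (w - x')) := by
    have := hG.fderiv
    erw [this] at hopt
    simpa [dotProductBilin] using hopt
  -- Young's inequality leaves a quadratic term in x - x', absorbed by the divergence of x' from x;
  -- the barrier part is only needed to be nonnegative, so no stability of the iterates is required.
  have hy := dotProduct_le_quadForm hA hβ g (x - x')
  have hd : β / 2 * ((x - x') ⬝ᵥ (A *ᵥ (x - x'))) ≤ quadLogDiv β A c x' x := by
    have h1 : (x - x') ⬝ᵥ (A *ᵥ (x - x')) = (x' - x) ⬝ᵥ (A *ᵥ (x' - x)) := by
      rw [← neg_sub x' x, Matrix.mulVec_neg, neg_dotProduct, dotProduct_neg, neg_neg]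
    have h2 : 0 ≤ ∑ i, c i * (x' i / x i - 1 - Real.log (x' i / x i)) :=
      Finset.sum_nonneg fun i _ => mul_nonneg (hc i)
        (sub_one_sub_log_nonneg (div_pos (hpos x' hx' i) (hpos x hx i)))
    rw [h1, quadLogDiv]
    linarith
  simp only [dotProduct_sub] at hopt2 hy ⊢
  linarith

/-! ### The plays of BARRONS -/

theorem barrons_spec (hN : 0 < N) (hT : 0 < T) (β η : ℝ) (r : ℕ → Fin N → ℝ) (t : ℕ) :
    barrons T β η r (t + 1) ∈ truncSimplex N T ∧
      IsMinOn (omdObjective T β η r (barrons T β η r) t) (truncSimplex N T)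
        (barrons T β η r (t + 1)) := by
  rw [barrons_succ]
  refine argmin_spec (isCompact_truncSimplex N T) ⟨_, uniform_mem_truncSimplex hN hT⟩ ?_
  intro y hy
  refine ContinuousAt.continuousWithinAt ?_
  have h1 : ContinuousAt (regularizer T β η r (barrons T β η r) t) y :=
    (differentiableAt_quadLog β _ _ (truncSimplex_pos hN hT hy)).continuousAt
  have h2 : ContinuousAt (fun y : Fin N → ℝ => y ⬝ᵥ lossGrad (r t) (barrons T β η r t)) y := by
    unfold dotProduct
    exact tendsto_finsetSum _ fun i _ => ((continuous_apply i).mul_const _).continuousAt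
  unfold omdObjective bregman
  fun_prop

theorem barrons_mem (hN : 0 < N) (hT : 0 < T) (β η : ℝ) (r : ℕ → Fin N → ℝ) (t : ℕ) :
    barrons T β η r t ∈ truncSimplex N T := by
  cases t with
  | zero => rw [barrons_zero]; exact uniform_mem_truncSimplex hN hT
  | succ t => exact (barrons_spec hN hT β η r t).1

end

/-! ### Losses and gradients -/

section

variable {N : ℕ} {T : ℕ}

theorem dotProduct_pos {r x : Fin N → ℝ} (hx : ∀ i, 0 < x i) (hr : (∀ i, 0 ≤ r i) ∧ ∃ i, 0 < r i) :
    0 < x ⬝ᵥ r := by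
  obtain ⟨i, hi⟩ := hr.2
  exact Finset.sum_pos' (fun j _ => mul_nonneg (hx j).le (hr.1 j))
    ⟨i, Finset.mem_univ i, mul_pos (hx i) hi⟩

theorem dotProduct_le_mul_of_le {r x y : Fin N → ℝ} {c : ℝ} (hr : ∀ i, 0 ≤ r i)
    (h : ∀ i, y i ≤ c * x i) : y ⬝ᵥ r ≤ c * (x ⬝ᵥ r) := by
  rw [dotProduct, dotProduct, Finset.mul_sum]
  refine Finset.sum_le_sum fun i _ => ?_
  rw [← mul_assoc]
  exact mul_le_mul_of_nonneg_right (h i) (hr i)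

theorem truncSimplex_le_mul (hN : 0 < N) (hT : 0 < T) {x y : Fin N → ℝ}
    (hx : x ∈ truncSimplex N T) (hy : ∀ i, y i ≤ 1) (i : Fin N) :
    y i ≤ (N * T : ℝ) * x i := by
  have hN' : (0 : ℝ) < N := by exact_mod_cast hN
  have hT' : (0 : ℝ) < T := by exact_mod_cast hT
  have := hx.2 i
  rw [div_le_iff₀' (by positivity)] at this
  exact (hy i).trans this

theorem lossGrad_dotProduct {r x w : Fin N → ℝ} (hx : 0 < x ⬝ᵥ r) :
    lossGrad r x ⬝ᵥ (x - w) = w ⬝ᵥ r / (x ⬝ᵥ r) - 1 := by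
  have h : ∀ y, lossGrad r x ⬝ᵥ y = -(y ⬝ᵥ r / (x ⬝ᵥ r)) := fun y => by
    simp only [lossGrad, dotProduct, Finset.sum_div, ← Finset.sum_neg_distrib]
    exact Finset.sum_congr rfl fun i _ => by ring
  rw [dotProduct_sub, h, h, div_self hx.ne']
  ring

theorem loss_sub_loss {r x w : Fin N → ℝ} (hx : 0 < x ⬝ᵥ r) (hw : 0 < w ⬝ᵥ r) :
    loss r x - loss r w = Real.log (w ⬝ᵥ r / (x ⬝ᵥ r)) := by
  rw [loss, loss, Real.log_div hw.ne' hx.ne']; ring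

theorem loss_sub_loss_le {r x w : Fin N → ℝ} {β : ℝ} (hβ : β ≤ 1 / 2) (hx : 0 < x ⬝ᵥ r)
    (hw : 0 < w ⬝ᵥ r) (h : β * (w ⬝ᵥ r) ≤ x ⬝ᵥ r) :
    loss r x - loss r w ≤
      lossGrad r x ⬝ᵥ (x - w) - β / 2 * (lossGrad r x ⬝ᵥ (x - w)) ^ 2 := by
  rw [loss_sub_loss hx hw, lossGrad_dotProduct hx]
  refine log_le_sub_sq (div_pos hw hx) hβ ?_
  rw [← mul_div_assoc, div_le_one hx]
  exact h

/-! ### The matrices `A_t` -/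

/-- The matrix `A_{n-1}`, built from the gradients of the first `n` rounds. -/
noncomputable def covBefore (r x : ℕ → Fin N → ℝ) (n : ℕ) : Matrix (Fin N) (Fin N) ℝ :=
  (N : ℝ) • (1 : Matrix (Fin N) (Fin N) ℝ) +
    ∑ s ∈ Finset.range n, Matrix.vecMulVec (lossGrad (r s) (x s)) (lossGrad (r s) (x s))

theorem covBefore_zero (r x : ℕ → Fin N → ℝ) :
    covBefore r x 0 = (N : ℝ) • (1 : Matrix (Fin N) (Fin N) ℝ) := by
  simp [covBefore]

theorem covBefore_succ (r x : ℕ → Fin N → ℝ) (n : ℕ) :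
    covBefore r x (n + 1) = covBefore r x n +
      Matrix.vecMulVec (lossGrad (r n) (x n)) (lossGrad (r n) (x n)) := by
  rw [covBefore, covBefore, Finset.sum_range_succ, add_assoc]

theorem covBefore_posDef (hN : 0 < N) (r x : ℕ → Fin N → ℝ) (n : ℕ) :
    (covBefore r x n).PosDef := by
  have hN' : (0 : ℝ) < N := by exact_mod_cast hN
  induction n with
  | zero => rw [covBefore_zero]; exact Matrix.PosDef.one.smul hN'
  | succ n ih =>
    rw [covBefore_succ]
    refine ih.add_posSemidef ?_
    simpa using Matrix.posSemidef_vecMulVec_self_star (lossGrad (r n) (x n))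

theorem log_nat_pos (hT : 2 ≤ T) : 0.69 ≤ Real.log T := by
  have h : (2 : ℝ) ≤ T := by exact_mod_cast hT
  have := Real.log_le_log (by norm_num) h
  linarith [Real.log_two_gt_d9]

theorem abs_lossGrad_le (hN : 0 < N) (hT : 0 < T) {r x : Fin N → ℝ}
    (hx : x ∈ truncSimplex N T) (hr : (∀ i, 0 ≤ r i) ∧ ∃ i, 0 < r i) (i : Fin N) :
    |lossGrad r x i| ≤ N * T := by
  have hp := dotProduct_pos (truncSimplex_pos hN hT hx) hr
  rw [lossGrad, neg_div, abs_neg, abs_of_nonneg (div_nonneg (hr.1 i) hp.le), div_le_iff₀ hp]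
  have h : (Pi.single i 1 : Fin N → ℝ) ⬝ᵥ r ≤ (N * T : ℝ) * (x ⬝ᵥ r) := by
    refine dotProduct_le_mul_of_le hr.1 (truncSimplex_le_mul hN hT hx fun j => ?_)
    rw [Pi.single_apply]; split_ifs <;> norm_num
  simpa using h

theorem log_det_covBefore_le (hN : 0 < N) (hNT : N < T) {r x : ℕ → Fin N → ℝ} {n : ℕ} (hn : n ≤ T)
    (hx : ∀ s, x s ∈ truncSimplex N T) (hr : ∀ s < n, (∀ i, 0 ≤ r s i) ∧ ∃ i, 0 < r s i) :
    Real.log (covBefore r x n).det - Real.log (covBefore r x 0).det ≤ 6 * N * Real.log T := by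
  have hT2 : 2 ≤ T := by omega
  have hN' : (1 : ℝ) ≤ N := by exact_mod_cast hN
  have hT' : (2 : ℝ) ≤ T := by exact_mod_cast hT2
  have hNT' : (N : ℝ) ≤ T := by exact_mod_cast hNT.le
  have htr : (covBefore r x n).trace ≤ N * (T : ℝ) ^ 6 := by
    have h1 : ∀ s ∈ Finset.range n,
        (Matrix.vecMulVec (lossGrad (r s) (x s)) (lossGrad (r s) (x s))).trace ≤
          N * (N * T : ℝ) ^ 2 := by
      intro s hs
      rw [Matrix.trace_vecMulVec, dotProduct]
      calc _ ≤ ∑ _i : Fin N, (N * T : ℝ) ^ 2 := by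
            refine Finset.sum_le_sum fun i _ => ?_
            rw [← sq]
            exact sq_le_sq' (neg_le_of_abs_le (abs_lossGrad_le hN (by omega) (hx s)
              (hr s (Finset.mem_range.1 hs)) i)) (le_of_abs_le (abs_lossGrad_le hN (by omega) (hx s)
              (hr s (Finset.mem_range.1 hs)) i))
        _ = _ := by simp
    have h2 := Finset.sum_le_sum h1
    rw [Finset.sum_const, Finset.card_range, nsmul_eq_mul] at h2
    rw [covBefore, Matrix.trace_add, Matrix.trace_sum, Matrix.trace_smul, Matrix.trace_one,
      Fintype.card_fin, smul_eq_mul]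
    have hnT : (n : ℝ) ≤ T := by exact_mod_cast hn
    have h3 : (n : ℝ) * (N * (N * T : ℝ) ^ 2) ≤ T * (N * (T * T : ℝ) ^ 2) := by gcongr
    have h4 : (N : ℝ) * N ≤ N * T := by gcongr
    have h5 : (T : ℝ) ≤ T ^ 5 := le_self_pow₀ (by linarith) (by norm_num)
    have h6 : (T : ℝ) ^ 5 * 2 ≤ T ^ 6 := by
      rw [pow_succ (T : ℝ) 5]; gcongr
    have h7 : (N : ℝ) * T + T * (N * (T * T : ℝ) ^ 2) ≤ N * T ^ 6 := by
      calc _ = N * (T + (T : ℝ) ^ 5) := by ring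
        _ ≤ N * T ^ 6 := by gcongr; linarith
    linarith
  have hpd := covBefore_posDef hN r x n
  have hdet := (posSemidef_det_le_trace_pow hpd.posSemidef).trans
    (pow_le_pow_left₀ hpd.posSemidef.trace_nonneg htr _)
  have hlog := Real.log_le_log hpd.det_pos hdet
  -- This cancels the N ln N coming from (N T⁶)^N, so only 6 N ln T remains.
  have h0 : Real.log (covBefore r x 0).det = N * Real.log N := by
    rw [covBefore_zero, Matrix.det_smul, Matrix.det_one, mul_one, Fintype.card_fin, Real.log_pow]
  rw [Fintype.card_fin, Real.log_pow, Real.log_mul (by positivity) (by positivity),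
    Real.log_pow] at hlog
  rw [h0]
  push_cast at hlog
  linarith

/-! ### The learning rates -/

/-- The exponent `max_{s ≤ t} log_T (1 / (N x_{s,i}))` of the learning rate. -/
noncomputable def rateExp (T : ℕ) (x : ℕ → Fin N → ℝ) (t : ℕ) (i : Fin N) : ℝ :=
  (Finset.range (t + 1)).sup' Finset.nonempty_range_add_one fun s => Real.logb T (1 / (N * x s i))

theorem learningRate_eq (η : ℝ) (x : ℕ → Fin N → ℝ) (t : ℕ) (i : Fin N) :
    learningRate T η x t i = η * Real.exp (rateExp T x t i) := rfl

theorem rateExp_zero (hN : 0 < N) {x : ℕ → Fin N → ℝ} (hx : x 0 = fun _ => 1 / (N : ℝ))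
    (i : Fin N) : rateExp T x 0 i = 0 := by
  have hN' : (N : ℝ) ≠ 0 := by exact_mod_cast hN.ne'
  simp [rateExp, hx, hN']

theorem rateExp_succ (x : ℕ → Fin N → ℝ) (t : ℕ) (i : Fin N) :
    rateExp T x (t + 1) i = max (rateExp T x t i) (Real.logb T (1 / (N * x (t + 1) i))) := by
  unfold rateExp
  refine eq_of_forall_ge_iff fun c => ?_
  simp only [Finset.sup'_le_iff, max_le_iff, Finset.mem_range]
  constructor
  · exact fun h => ⟨fun s hs => h s (by omega), h _ (by omega)⟩
  · rintro ⟨h1, h2⟩ s hs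
    rcases Nat.lt_succ_iff_lt_or_eq.1 hs with h | rfl
    · exact h1 s h
    · exact h2

theorem exp_logb_mul_log (hT : 2 ≤ T) {y : ℝ} (hy : 0 < y) :
    Real.exp (Real.logb T y * Real.log T) = y := by
  rw [Real.logb, div_mul_cancel₀, Real.exp_log hy]
  linarith [log_nat_pos hT]

theorem le_exp_rateExp (hN : 0 < N) (hT : 2 ≤ T) {x : ℕ → Fin N → ℝ} {s t : ℕ} (hst : s ≤ t)
    {i : Fin N} (hx : 0 < x s i) :
    1 / (N * x s i) ≤ Real.exp (rateExp T x t i * Real.log T) := by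
  have hN' : (0 : ℝ) < N := by exact_mod_cast hN
  rw [← exp_logb_mul_log hT (show 0 < 1 / (N * x s i) by positivity)]
  have hL := log_nat_pos hT
  have : Real.logb T (1 / (N * x s i)) ≤ rateExp T x t i :=
    Finset.le_sup' (fun s => Real.logb T (1 / (N * x s i))) (Finset.mem_range.2 (by omega))
  gcongr

theorem logb_le_one (hN : 0 < N) (hT : 2 ≤ T) {x : Fin N → ℝ} (hx : x ∈ truncSimplex N T)
    (i : Fin N) : Real.logb T (1 / (N * x i)) ≤ 1 := by
  have hN' : (0 : ℝ) < N := by exact_mod_cast hN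
  have hT' : (2 : ℝ) ≤ T := by exact_mod_cast hT
  have hp := truncSimplex_pos hN (by omega) hx i
  rw [Real.logb_le_iff_le_rpow (by linarith) (by positivity), Real.rpow_one,
    div_le_iff₀ (by positivity)]
  have := truncSimplex_le_mul hN (by omega) hx (fun _ => le_refl (1 : ℝ)) i
  linarith

/-! ### The regret of BARRONS -/

theorem quadLogDiv_add_vecMulVec (β : ℝ) (A : Matrix (Fin N) (Fin N) ℝ) (c g w x : Fin N → ℝ) :
    quadLogDiv β (A + Matrix.vecMulVec g g) c w x =
      quadLogDiv β A c w x + β / 2 * (g ⬝ᵥ (x - w)) ^ 2 := by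
  have h : (g ⬝ᵥ (w - x)) ^ 2 = (g ⬝ᵥ (x - w)) ^ 2 := by
    rw [← neg_sub x w, dotProduct_neg, neg_sq]
  rw [quadLogDiv, quadLogDiv, Matrix.add_mulVec, dotProduct_add, vecMulVec_quadForm, h]
  ring

/-- Induction on a potential: divergence from the current play plus a multiple of ∑ max(N w_i e^{g_i
ln T}, 6), with g_i the rate exponent. The divergence pairs the first n gradients with rates that
already account for the play x_n, so the change of matrix and the change of rates are separate
steps. -/
theorem barrons_potential (hN : 0 < N) (hT : 2 ≤ T) {β η : ℝ} (hβ : 0 < β) (hη : 0 < η)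
    (r : ℕ → Fin N → ℝ) {x : ℕ → Fin N → ℝ} (hx : x = barrons T β η r) {w : Fin N → ℝ}
    (hw : w ∈ truncSimplex N T) (n : ℕ) :
    ∑ s ∈ Finset.range n, (lossGrad (r s) (x s) ⬝ᵥ (x s - w) -
        β / 2 * (lossGrad (r s) (x s) ⬝ᵥ (x s - w)) ^ 2) +
      quadLogDiv β (covBefore r x n) (fun i => 1 / learningRate T η x n i) w (x n) +
      1 / (2 * Real.exp 1 * η * Real.log T) *
        ∑ i, max (N * w i * Real.exp (rateExp T x n i * Real.log T)) 6 ≤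
    quadLogDiv β (covBefore r x 0) (fun _ => 1 / η) w (x 0) +
      1 / (2 * Real.exp 1 * η * Real.log T) * ∑ i, max (N * w i) 6 +
      1 / (2 * β) * (Real.log (covBefore r x n).det - Real.log (covBefore r x 0).det) := by
  have hT0 : 0 < T := by omega
  have hN' : (0 : ℝ) < N := by exact_mod_cast hN
  have hL : 0 < Real.log T := by linarith [log_nat_pos hT]
  have hxm : ∀ t, x t ∈ truncSimplex N T := fun t => hx ▸ barrons_mem hN hT0 β η r t
  have hwp := truncSimplex_pos hN hT0 hw
  induction n with
  | zero =>
    have h0 : x 0 = fun _ => 1 / (N : ℝ) := by rw [hx, barrons_zero]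
    have h1 : ∀ i, rateExp T x 0 i = 0 := rateExp_zero hN h0
    simp [learningRate_eq, h1]
  | succ n ih =>
    have hxp := truncSimplex_pos hN hT0 (hxm (n + 1))
    have hmin := (barrons_spec hN hT0 β η r n).2
    rw [← hx] at hmin
    -- `covBefore r x (n + 1)` is A_n by definition, so `hmin` fits. The matrix contains the current
    -- gradient, as the log-determinant bound requires.
    have hstep := omd_step (convex_truncSimplex N T) (fun y hy => truncSimplex_pos hN hT0 hy) hβ
      (covBefore_posDef hN r x (n + 1)) (c := fun i => 1 / learningRate T η x n i)
      (fun i => by rw [learningRate_eq]; positivity) (hxm n) (hxm (n + 1)) hw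
      (g := lossGrad (r n) (x n)) hmin
    have hlog := dotProduct_inv_mulVec_le_log_det (covBefore_posDef hN r x n) (lossGrad (r n) (x n))
    rw [← covBefore_succ] at hlog
    have hlog' := mul_le_mul_of_nonneg_left hlog (show 0 ≤ 1 / (2 * β) by positivity)
    have hquad := quadLogDiv_add_vecMulVec β (covBefore r x n)
      (fun i => 1 / learningRate T η x n i) (lossGrad (r n) (x n)) w (x n)
    rw [← covBefore_succ] at hquad
    have hbar : quadLogDiv β (covBefore r x (n + 1)) (fun i => 1 / learningRate T η x (n + 1) i) w
          (x (n + 1)) +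
        1 / (2 * Real.exp 1 * η * Real.log T) *
          ∑ i, max (N * w i * Real.exp (rateExp T x (n + 1) i * Real.log T)) 6 ≤
        quadLogDiv β (covBefore r x (n + 1)) (fun i => 1 / learningRate T η x n i) w (x (n + 1)) +
        1 / (2 * Real.exp 1 * η * Real.log T) *
          ∑ i, max (N * w i * Real.exp (rateExp T x n i * Real.log T)) 6 := by
      rw [quadLogDiv, quadLogDiv, add_assoc, add_assoc, Finset.mul_sum, Finset.mul_sum,
        ← Finset.sum_add_distrib, ← Finset.sum_add_distrib]
      refine add_le_add_right (Finset.sum_le_sum fun i _ => ?_) _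
      have h := barrier_change_le hL hη (logb_le_one hN hT (hxm (n + 1)) i)
        (g := rateExp T x n i) (N * w i) (div_pos (hwp i) (hxp i)) (by
          have := hxp i
          rw [exp_logb_mul_log hT (by positivity)]
          field_simp)
      rw [← rateExp_succ] at h
      simp only [learningRate_eq]
      linarith
    rw [Finset.sum_range_succ]
    linarith
end

section

variable {N T : ℕ}

theorem adaEta_pos (hN : 0 < N) (hT : 2 ≤ T) : 0 < adaEta N T := by
  have hN' : (0 : ℝ) < N := by exact_mod_cast hN
  have hL := log_nat_pos hT
  have : 0 < Real.log T := by linarith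
  unfold adaEta
  positivity

theorem log_mul_le (hN : 0 < N) (hNT : N < T) : Real.log (N * T) ≤ 2 * Real.log T := by
  have hN' : (0 : ℝ) < N := by exact_mod_cast hN
  have hNT' : (N : ℝ) ≤ T := by exact_mod_cast hNT.le
  rw [Real.log_mul hN'.ne' (by linarith)]
  linarith [Real.log_le_log hN' hNT']

/-- The linear part of the barrier vanishes because ∑ (N w_i - 1) = 0; what remains is -ln(N w_i) ≤
ln T per coordinate. -/
theorem quadLogDiv_uniform_le (hN : 0 < N) (hT : 2 ≤ T) {β η : ℝ} (hβ : 0 < β) (hβ2 : β ≤ 1 / 2)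
    (hη : 0 < η) {w : Fin N → ℝ} (hw : w ∈ truncSimplex N T) :
    quadLogDiv β ((N : ℝ) • (1 : Matrix (Fin N) (Fin N) ℝ)) (fun _ => 1 / η) w
      (fun _ => 1 / (N : ℝ)) ≤ (N : ℝ) ^ 2 / 4 + N * Real.log T / η := by
  have hT0 : 0 < T := by omega
  have hN' : (0 : ℝ) < N := by exact_mod_cast hN
  have hT' : (0 : ℝ) < T := by exact_mod_cast hT0
  have hu := uniform_mem_truncSimplex hN hT0
  have hq : (w - fun _ => 1 / (N : ℝ)) ⬝ᵥ
      (((N : ℝ) • (1 : Matrix (Fin N) (Fin N) ℝ)) *ᵥ (w - fun _ => 1 / (N : ℝ))) ≤ (N : ℝ) ^ 2 := by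
    rw [Matrix.smul_mulVec, Matrix.one_mulVec, dotProduct_smul, smul_eq_mul, sq]
    gcongr
    calc _ ≤ ∑ _i : Fin N, (1 : ℝ) := by
          refine Finset.sum_le_sum fun i _ => ?_
          have h1 := truncSimplex_pos hN hT0 hw i
          have h2 := truncSimplex_le_one hw i
          have h3 := truncSimplex_pos hN hT0 hu i
          have h4 := truncSimplex_le_one hu i
          simp only [Pi.sub_apply] at h3 h4 ⊢
          nlinarith
      _ = N := by simp
  have hs : ∑ i, 1 / η * (w i / (1 / (N : ℝ)) - 1 - Real.log (w i / (1 / (N : ℝ)))) ≤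
      N * Real.log T / η := by
    rw [← Finset.mul_sum, Finset.sum_sub_distrib, Finset.sum_sub_distrib, ← Finset.sum_div, hw.1.2]
    have h1 : ∑ i, -Real.log (w i / (1 / (N : ℝ))) ≤ ∑ _i : Fin N, Real.log T := by
      refine Finset.sum_le_sum fun i _ => ?_
      have hp := truncSimplex_pos hN hT0 hw i
      have h := truncSimplex_le_mul hN hT0 hw (fun _ => le_refl (1 : ℝ)) i
      rw [← Real.log_inv]
      refine Real.log_le_log (by positivity) ?_
      rw [inv_le_comm₀ (by positivity) hT', div_div_eq_mul_div, div_one, inv_le_iff_one_le_mul₀ hT']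
      linarith
    rw [Finset.sum_neg_distrib] at h1
    simp only [Finset.sum_const, Finset.card_univ, Fintype.card_fin, nsmul_eq_mul, mul_one,
      one_div_one_div] at h1 ⊢
    have : 1 / η * (N - N - ∑ i, Real.log (w i / (1 / (N : ℝ)))) ≤ 1 / η * (N * Real.log T) := by
      gcongr; linarith
    calc _ ≤ _ := this
      _ = _ := by ring
  unfold quadLogDiv
  have hN2 : (0 : ℝ) ≤ (N : ℝ) ^ 2 := by positivity
  have h1 := mul_le_mul_of_nonneg_left hq (show 0 ≤ β / 2 by positivity)
  have h2 : β / 2 * (N : ℝ) ^ 2 ≤ 1 / 2 / 2 * (N : ℝ) ^ 2 := by gcongr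
  beta_reduce
  linarith

/-- The regret of BARRONS with the parameter `η` of Ada-BARRONS, with the negative term that comes from
the increasing learning rates. -/
theorem barrons_regret (hN : 0 < N) (hNT : N < T) {β : ℝ} (hβ : 0 < β) (hβ2 : β ≤ 1 / 2)
    {r x : ℕ → Fin N → ℝ} (hx : x = barrons T β (adaEta N T) r) {n : ℕ} (hn : n ≤ T)
    (hr : ∀ s < n, (∀ i, 0 ≤ r s i) ∧ ∃ i, 0 < r s i) {w : Fin N → ℝ} (hw : w ∈ truncSimplex N T)
    (hwr : ∀ s < n, β * (w ⬝ᵥ r s) ≤ x s ⬝ᵥ r s) {s₀ : ℕ} (hs₀ : s₀ ≤ n) (i₀ : Fin N) :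
    ∑ s ∈ Finset.range n, (loss (r s) (x s) - loss (r s) w) +
      360 * (N * Real.log T) * (w i₀ / x s₀ i₀) ≤
    8000 * (N ^ 2 * Real.log T ^ 3) + 3 * (N * Real.log T) / β := by
  have hT2 : 2 ≤ T := by omega
  have hT0 : 0 < T := by omega
  have hN' : (1 : ℝ) ≤ N := by exact_mod_cast hN
  have hL69 := log_nat_pos hT2
  have hxm : ∀ t, x t ∈ truncSimplex N T := fun t => hx ▸ barrons_mem hN hT0 β _ r t
  have hxp : ∀ t i, 0 < x t i := fun t => truncSimplex_pos hN hT0 (hxm t)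
  have hwp := truncSimplex_pos hN hT0 hw
  have hpot := barrons_potential hN hT2 hβ (adaEta_pos hN hT2) r hx hw n
  have hdet := log_det_covBefore_le hN hNT hn hxm hr
  have hx0 : x 0 = fun _ => 1 / (N : ℝ) := by rw [hx, barrons_zero]
  rw [hx0] at hpot
  have hu := quadLogDiv_uniform_le hN hT2 hβ hβ2 (adaEta_pos hN hT2) hw
  rw [← covBefore_zero r x] at hu
  have hloss : ∑ s ∈ Finset.range n, (loss (r s) (x s) - loss (r s) w) ≤
      ∑ s ∈ Finset.range n, (lossGrad (r s) (x s) ⬝ᵥ (x s - w) -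
        β / 2 * (lossGrad (r s) (x s) ⬝ᵥ (x s - w)) ^ 2) :=
    Finset.sum_le_sum fun s hs => by
      have hs' := Finset.mem_range.1 hs
      exact loss_sub_loss_le hβ2 (dotProduct_pos (hxp s) (hr s hs')) (dotProduct_pos hwp (hr s hs'))
        (hwr s hs')
  have hdiv : 0 ≤ quadLogDiv β (covBefore r x n)
      (fun i => 1 / learningRate T (adaEta N T) x n i) w (x n) := by
    have h1 := posSemidef_quadForm_nonneg (covBefore_posDef hN r x n).posSemidef (w - x n)
    have h2 : 0 ≤ ∑ i, 1 / learningRate T (adaEta N T) x n i *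
        (w i / x n i - 1 - Real.log (w i / x n i)) :=
      Finset.sum_nonneg fun i _ => mul_nonneg
        (by rw [learningRate_eq]; have := adaEta_pos hN hT2; positivity)
        (sub_one_sub_log_nonneg (div_pos (hwp i) (hxp n i)))
    unfold quadLogDiv
    positivity
  -- The case s₀ = n is included because the rates at index n see x_n, although only n rounds of
  -- loss are counted. An epoch may be ended by its last play.
  have hmax : w i₀ / x s₀ i₀ ≤ ∑ i, max (N * w i * Real.exp (rateExp T x n i * Real.log T)) 6 := by
    have h1 := le_exp_rateExp hN hT2 hs₀ (hxp s₀ i₀)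
    have h2 : w i₀ / x s₀ i₀ = N * w i₀ * (1 / (N * x s₀ i₀)) := by field_simp
    calc w i₀ / x s₀ i₀ ≤ N * w i₀ * Real.exp (rateExp T x n i₀ * Real.log T) := by
          rw [h2]; have := hwp i₀; gcongr
      _ ≤ max (N * w i₀ * Real.exp (rateExp T x n i₀ * Real.log T)) 6 := le_max_left _ _
      _ ≤ _ := Finset.single_le_sum
          (f := fun i => max (N * w i * Real.exp (rateExp T x n i * Real.log T)) 6)
          (fun i _ => le_max_of_le_right (by norm_num)) (Finset.mem_univ i₀)
  have hmax0 : ∑ i, max (N * w i) 6 ≤ 7 * N := by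
    calc _ ≤ ∑ i, (N * w i + 6) := Finset.sum_le_sum fun i _ => by
          have := hwp i
          exact max_le (by linarith) (by nlinarith)
      _ = 7 * N := by
          rw [Finset.sum_add_distrib, ← Finset.mul_sum, hw.1.2]; simp; ring
  set L := Real.log T with hLdef
  -- The value of η makes the coefficient of the potential proportional to N ln T, the same scale as
  -- the log-determinant cost.
  have hκ : 1 / (2 * Real.exp 1 * adaEta N T * L) = 1024 / Real.exp 1 * (N * L) := by
    rw [adaEta, ← hLdef]; field_simp; norm_num
  have hκ1 : 360 ≤ 1024 / Real.exp 1 := by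
    rw [le_div_iff₀ (Real.exp_pos 1)]; linarith [Real.exp_one_lt_d9]
  have hκ2 : 1024 / Real.exp 1 ≤ 380 := by
    rw [div_le_iff₀ (Real.exp_pos 1)]; linarith [Real.exp_one_gt_d9]
  have hη : N * L / adaEta N T = 2048 * (N ^ 2 * L ^ 3) := by
    rw [adaEta, ← hLdef]; field_simp
  rw [hκ] at hpot
  rw [hη] at hu
  have hNL : 0 < N * L := by positivity
  have hY : 0 ≤ w i₀ / x s₀ i₀ := (div_pos (hwp i₀) (hxp s₀ i₀)).le
  have h1 : 360 * (N * L) * (w i₀ / x s₀ i₀) ≤ 1024 / Real.exp 1 * (N * L) *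
      ∑ i, max (N * w i * Real.exp (rateExp T x n i * L)) 6 := by gcongr
  have h2 : 1024 / Real.exp 1 * (N * L) * ∑ i, max (N * w i) 6 ≤ 380 * (N * L) * (7 * N) := by
    gcongr
  have h3 : 1 / (2 * β) * (Real.log (covBefore r x n).det - Real.log (covBefore r x 0).det) ≤
      1 / (2 * β) * (6 * N * L) := by gcongr
  have h4 : 1 / (2 * β) * (6 * N * L) = 3 * (N * L) / β := by field_simp; norm_num
  have hL3 : 0.32 ≤ L ^ 3 := by
    calc (0.32 : ℝ) ≤ 0.69 ^ 3 := by norm_num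
      _ ≤ L ^ 3 := by gcongr
  have hLL3 : 0.47 * L ≤ L ^ 3 := by
    have hL2 : 0.47 ≤ L ^ 2 := by nlinarith
    rw [pow_succ]; gcongr
  have h5 : (N : ℝ) ^ 2 * 0.32 ≤ N ^ 2 * L ^ 3 := by gcongr
  have h6 : (N : ℝ) ^ 2 * (0.47 * L) ≤ N ^ 2 * L ^ 3 := by gcongr
  nlinarith

/-! ### The regularized leader -/

theorem continuousAt_loss {r y : Fin N → ℝ} (h : 0 < y ⬝ᵥ r) : ContinuousAt (loss r) y :=
  (hasFDerivAt_loss h).continuousAt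

/-- The barrier is nonnegative at the leader and at most N ln(NT) ≤ 2 N ln T at v, with weight 1/γ =
25. -/
theorem regLeader_spec (hN : 0 < N) (hNT : N < T) {r : ℕ → Fin N → ℝ} {t : ℕ}
    (hr : ∀ s ≤ t, (∀ i, 0 ≤ r s i) ∧ ∃ i, 0 < r s i) :
    regLeader T adaGamma r t ∈ truncSimplex N T ∧ ∀ v ∈ truncSimplex N T,
      ∑ s ∈ Finset.range (t + 1), loss (r s) (regLeader T adaGamma r t) ≤
        ∑ s ∈ Finset.range (t + 1), loss (r s) v + 50 * (N * Real.log T) := by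
  have hT0 : 0 < T := by omega
  have hN' : (0 : ℝ) < N := by exact_mod_cast hN
  have hT' : (0 : ℝ) < T := by exact_mod_cast hT0
  obtain ⟨hmem, hmin⟩ := argmin_spec (F := fun u =>
      (∑ s ∈ Finset.range (t + 1), loss (r s) u) + 1 / adaGamma * ∑ i, Real.log (1 / u i))
    (isCompact_truncSimplex N T) ⟨_, uniform_mem_truncSimplex hN hT0⟩ (by
      intro y hy
      refine ContinuousAt.continuousWithinAt (ContinuousAt.add ?_ (ContinuousAt.mul ?_ ?_))
      · refine tendsto_finsetSum _ fun s hs => continuousAt_loss (dotProduct_pos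
          (truncSimplex_pos hN hT0 hy) (hr s (Nat.lt_succ_iff.1 (Finset.mem_range.1 hs))))
      · exact continuousAt_const
      · refine tendsto_finsetSum _ fun i _ => ?_
        have hyi := (truncSimplex_pos hN hT0 hy i).ne'
        have h : ContinuousAt (fun u : Fin N → ℝ => u i) y := (continuous_apply i).continuousAt
        simp only [one_div]
        exact (h.inv₀ hyi).log (inv_ne_zero hyi))
  change regLeader T adaGamma r t ∈ _ at hmem
  change IsMinOn _ _ (regLeader T adaGamma r t) at hmin
  refine ⟨hmem, fun v hv => ?_⟩
  have h := isMinOn_iff.1 hmin v hv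
  have h1 : 0 ≤ ∑ i, Real.log (1 / regLeader T adaGamma r t i) :=
    Finset.sum_nonneg fun i _ => Real.log_nonneg (by
      rw [le_div_iff₀ (truncSimplex_pos hN hT0 hmem i), one_mul]
      exact truncSimplex_le_one hmem i)
  have h2 : ∑ i, Real.log (1 / v i) ≤ N * (2 * Real.log T) := by
    calc _ ≤ ∑ _i : Fin N, 2 * Real.log T := by
          refine Finset.sum_le_sum fun i _ => ?_
          have hvi := truncSimplex_pos hN hT0 hv i
          refine (Real.log_le_log (by positivity) ?_).trans (log_mul_le hN hNT)
          rw [div_le_iff₀ hvi]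
          exact truncSimplex_le_mul hN hT0 hv (fun _ => le_refl (1 : ℝ)) i
      _ = _ := by simp
  have hγ : 1 / adaGamma = 25 := by norm_num [adaGamma]
  rw [hγ] at h
  linarith

theorem loss_combo_le {r a b : Fin N → ℝ} {l : ℝ} (ha : 0 < a ⬝ᵥ r) (hb : 0 < b ⬝ᵥ r)
    (hl0 : 0 ≤ l) (hl1 : l ≤ 1) :
    loss r ((1 - l) • a + l • b) ≤ (1 - l) * loss r a + l * loss r b := by
  have h := strictConcaveOn_log_Ioi.concaveOn.2 ha hb (sub_nonneg.2 hl1) hl0 (by ring)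
  simp only [smul_eq_mul] at h
  simp only [loss, add_dotProduct, smul_dotProduct, smul_eq_mul]
  linarith

/-- ⟨w, r⟩ / ⟨x, r⟩ is a weighted average of the ratios w_i / x_i, so some ratio is at least as
large. -/
theorem exists_ratio_ge {r x w : Fin N → ℝ} {c : ℝ} (hx : ∀ i, 0 < x i)
    (hr : (∀ i, 0 ≤ r i) ∧ ∃ i, 0 < r i) (h : c * (x ⬝ᵥ r) ≤ w ⬝ᵥ r) : ∃ i, c ≤ w i / x i := by
  by_contra! hlt
  refine absurd h (not_le.2 ?_)
  obtain ⟨i, hi⟩ := hr.2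
  have hlt' : ∀ j, w j < c * x j := fun j => (div_lt_iff₀ (hx j)).1 (hlt j)
  rw [dotProduct, dotProduct, Finset.mul_sum]
  refine Finset.sum_lt_sum (fun j _ => ?_) ⟨i, Finset.mem_univ i, ?_⟩
  · rw [← mul_assoc]; exact mul_le_mul_of_nonneg_right (hlt' j).le (hr.1 j)
  · rw [← mul_assoc]; exact mul_lt_mul_of_pos_right (hlt' i) hi

theorem exists_ratio_ge_one {x w : Fin N → ℝ} (hN : 0 < N) (hT : 0 < T)
    (hx : x ∈ truncSimplex N T) (hw : w ∈ truncSimplex N T) : ∃ i, 1 ≤ w i / x i := by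
  refine exists_ratio_ge (r := fun _ => 1) (truncSimplex_pos hN hT hx)
    ⟨fun _ => zero_le_one, ⟨0, hN⟩, one_pos⟩ ?_
  have h : ∀ y ∈ truncSimplex N T, y ⬝ᵥ (fun _ => (1 : ℝ)) = 1 := fun y hy => by
    simpa [dotProduct] using hy.1.2
  rw [h x hx, h w hw, one_mul]

/-! ### The restart condition -/

theorem sub_dotProduct_lossGrad {r x u : Fin N → ℝ} (hx : 0 < x ⬝ᵥ r) :
    |(u - x) ⬝ᵥ lossGrad r x| = |u ⬝ᵥ r / (x ⬝ᵥ r) - 1| := by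
  rw [← lossGrad_dotProduct hx (w := u), dotProduct_comm, ← neg_sub x u, dotProduct_neg, abs_neg]

theorem ofReal_le_one_div_ofReal {β z : ℝ} (hβ : 0 < β) :
    ENNReal.ofReal β ≤ 1 / ENNReal.ofReal z ↔ β * z ≤ 1 := by
  rcases le_or_gt z 0 with hz | hz
  · rw [ENNReal.ofReal_of_nonpos hz]
    simp only [ENNReal.div_zero one_ne_zero, le_top, true_iff]
    nlinarith
  · rw [← ENNReal.ofReal_one, ← ENNReal.ofReal_div_of_pos hz, ENNReal.ofReal_le_ofReal_iff (by positivity),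
      le_div_iff₀ hz]

/-- The bound β ≤ 1/2 disposes of the entry 1/2 of the minimum, and the product form also covers the
convention 1/0 = ∞. -/
theorem ofReal_le_alpha_iff {β : ℝ} (hβ : 0 < β) (hβ2 : β ≤ 1 / 2) {r x : ℕ → Fin N → ℝ} {t : ℕ}
    (hx : ∀ s ≤ t, 0 < x s ⬝ᵥ r s) {u : Fin N → ℝ} :
    ENNReal.ofReal β ≤ alpha r x t u ↔
      ∀ s ≤ t, β * (8 * |u ⬝ᵥ r s / (x s ⬝ᵥ r s) - 1|) ≤ 1 := by
  have hhalf : ENNReal.ofReal β ≤ 1 / 2 := by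
    rw [show (1 / 2 : ℝ≥0∞) = 1 / ENNReal.ofReal 2 by simp, ofReal_le_one_div_ofReal hβ]
    linarith
  simp only [alpha, le_min_iff, hhalf, true_and, le_iInf_iff, Finset.mem_range, Nat.lt_succ_iff]
  refine forall₂_congr fun s hs => ?_
  rw [ofReal_le_one_div_ofReal hβ, sub_dotProduct_lossGrad (hx s hs)]

end

/-! ### The regret of an epoch -/

section

variable {N T : ℕ}

theorem loss_sub_loss_le_two_log (hN : 0 < N) (hNT : N < T) {r x v : Fin N → ℝ}
    (hx : x ∈ truncSimplex N T) (hv : v ∈ truncSimplex N T)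
    (hr : (∀ i, 0 ≤ r i) ∧ ∃ i, 0 < r i) : loss r x - loss r v ≤ 2 * Real.log T := by
  have hT0 : 0 < T := by omega
  have hxr := dotProduct_pos (truncSimplex_pos hN hT0 hx) hr
  have hvr := dotProduct_pos (truncSimplex_pos hN hT0 hv) hr
  rw [loss_sub_loss hxr hvr]
  refine (Real.log_le_log (div_pos hvr hxr) ?_).trans (log_mul_le hN hNT)
  rw [div_le_iff₀ hxr]
  exact dotProduct_le_mul_of_le hr.1 (truncSimplex_le_mul hN hT0 hx (truncSimplex_le_one hv))

theorem mul_log_le (hN : 0 < N) (hNT : N < T) :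
    N * Real.log T ≤ 2.2 * (N ^ 2 * Real.log T ^ 3) := by
  have hN' : (1 : ℝ) ≤ N := by exact_mod_cast hN
  have hL := log_nat_pos (show 2 ≤ T by omega)
  have h1 : 1 ≤ 2.2 * (N * Real.log T ^ 2) := by
    have : (0.69 : ℝ) ^ 2 ≤ Real.log T ^ 2 := by gcongr
    nlinarith
  calc N * Real.log T = N * Real.log T * 1 := by ring
    _ ≤ N * Real.log T * (2.2 * (N * Real.log T ^ 2)) := by gcongr
    _ = _ := by ring

/-- The leader is computed with round n included, while the comparator must compete on the rounds
before it; discarding one round costs at most 2 ln T. -/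
theorem regLeader_near_optimal_pred (hN : 0 < N) (hNT : N < T) {r : ℕ → Fin N → ℝ} {n : ℕ}
    (hr : ∀ s ≤ n, (∀ i, 0 ≤ r s i) ∧ ∃ i, 0 < r s i) {v : Fin N → ℝ} (hv : v ∈ truncSimplex N T) :
    ∑ s ∈ Finset.range n, loss (r s) (regLeader T adaGamma r n) ≤
      ∑ s ∈ Finset.range n, loss (r s) v + 52 * (N * Real.log T) := by
  have hT0 : 0 < T := by omega
  have hN' : (1 : ℝ) ≤ N := by exact_mod_cast hN
  obtain ⟨hmem, hopt⟩ := regLeader_spec hN hNT hr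
  have h := hopt v hv
  rw [Finset.sum_range_succ, Finset.sum_range_succ] at h
  have h1 := loss_sub_loss_le_two_log hN hNT hv hmem (hr n le_rfl)
  have hL := log_nat_pos (show 2 ≤ T by omega)
  nlinarith

/-- When an epoch ends after its round `n`, some portfolio in the truncated simplex is nearly optimal for
the first `n` rounds, satisfies the curvature condition for `β`, and is far from some play. -/
theorem exists_comparator (hN : 0 < N) (hNT : N < T) {β : ℝ} (hβ : 0 < β) (hβ2 : β ≤ 1 / 2)
    {r x : ℕ → Fin N → ℝ} (hx : ∀ s, x s ∈ truncSimplex N T) {n : ℕ}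
    (hr : ∀ s ≤ n, (∀ i, 0 ≤ r s i) ∧ ∃ i, 0 < r s i)
    (hprev : ∀ m, n = m + 1 → ENNReal.ofReal β ≤ alpha r x m (regLeader T adaGamma r m))
    (hend : alpha r x n (regLeader T adaGamma r n) < ENNReal.ofReal β) :
    ∃ w ∈ truncSimplex N T, (∀ s < n, β * (w ⬝ᵥ r s) ≤ x s ⬝ᵥ r s) ∧
      (∀ v ∈ truncSimplex N T, ∑ s ∈ Finset.range n, loss (r s) w ≤
        ∑ s ∈ Finset.range n, loss (r s) v + 52 * (N * Real.log T)) ∧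
      ∃ s ≤ n, ∃ i, 1 / (8 * β) ≤ w i / x s i := by
  have hT0 : 0 < T := by omega
  have hN' : (1 : ℝ) ≤ N := by exact_mod_cast hN
  have hL := log_nat_pos (show 2 ≤ T by omega)
  have hxp : ∀ s i, 0 < x s i := fun s => truncSimplex_pos hN hT0 (hx s)
  have hxr : ∀ s ≤ n, 0 < x s ⬝ᵥ r s := fun s hs => dotProduct_pos (hxp s) (hr s hs)
  set b := regLeader T adaGamma r n with hb
  obtain ⟨hbm, -⟩ := regLeader_spec hN hNT hr
  have hbp := truncSimplex_pos hN hT0 hbm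
  have hbopt := fun v hv => regLeader_near_optimal_pred hN hNT hr (v := v) hv
  rw [← hb] at hbm hbp hbopt
  -- If the new leader b satisfies the curvature condition it serves as w, and the failed test
  -- provides the large ratio.
  by_cases hall : ∀ s < n, β * (b ⬝ᵥ r s) ≤ x s ⬝ᵥ r s
  · refine ⟨b, hbm, hall, hbopt, ?_⟩
    have h := (ofReal_le_alpha_iff hβ hβ2 hxr (u := b)).not.1 (not_le.2 hend)
    push Not at h
    obtain ⟨s, hs, h⟩ := h
    refine ⟨s, hs, ?_⟩
    have hb0 : 0 < b ⬝ᵥ r s / (x s ⬝ᵥ r s) := div_pos (dotProduct_pos hbp (hr s hs)) (hxr s hs)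
    have h8 : 1 / (8 * β) ≤ |b ⬝ᵥ r s / (x s ⬝ᵥ r s) - 1| := by
      rw [div_le_iff₀ (by positivity)]; linarith
    -- Below 1 the deviation is less than 1, so the target 1/(8β) is less than 1, and two
    -- probability vectors always have a ratio of at least 1.
    rcases le_or_gt (b ⬝ᵥ r s / (x s ⬝ᵥ r s)) 1 with h1 | h1
    · rw [abs_of_nonpos (by linarith)] at h8
      obtain ⟨i, hi⟩ := exists_ratio_ge_one hN hT0 (hx s) hbm
      exact ⟨i, by linarith⟩
    · rw [abs_of_pos (by linarith)] at h8
      refine exists_ratio_ge (hxp s) (hr s hs) ?_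
      rw [← le_div_iff₀ (hxr s hs)]
      linarith
  · push Not at hall
    obtain ⟨s₁, hs₁, hbs⟩ := hall
    -- The violation at s₁ < n shows that n is positive, so there is a previous leader a, and it
    -- passed its test.
    obtain ⟨m, rfl⟩ : ∃ m, n = m + 1 := ⟨n - 1, by omega⟩
    set a := regLeader T adaGamma r m with ha
    obtain ⟨ham, haopt⟩ := regLeader_spec hN hNT (r := r) (t := m) (fun s hs => hr s (by omega))
    have hal := (ofReal_le_alpha_iff hβ hβ2 (fun s hs => hxr s (by omega))).1 (hprev m rfl)
    rw [← ha] at ham haopt hal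
    have hap := truncSimplex_pos hN hT0 ham
    set M : ℕ → (Fin N → ℝ) → ℝ := fun s w => w ⬝ᵥ r s / (x s ⬝ᵥ r s) with hM
    set φ : ℝ → ℝ := fun l => (Finset.range (m + 1)).sup' Finset.nonempty_range_add_one
      fun s => M s ((1 - l) • a + l • b) with hφ
    have hφc : Continuous φ := by
      refine Continuous.finset_sup'_apply _ fun s _ => ?_
      simp only [hM, add_dotProduct, smul_dotProduct, smul_eq_mul]
      fun_prop
    -- The test gives β M_s(a) ≤ β + 1/8 ≤ 5/8.
    have h0 : φ 0 ≤ 1 / β := by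
      refine Finset.sup'_le _ _ fun s hs => ?_
      have h := hal s (by simpa [Nat.lt_succ_iff] using hs)
      have h' := mul_le_mul_of_nonneg_left (le_abs_self (a ⬝ᵥ r s / (x s ⬝ᵥ r s) - 1)) hβ.le
      rw [le_div_iff₀ hβ]
      simp only [hM, sub_zero, one_smul, zero_smul, add_zero]
      nlinarith
    have h1 : 1 / β ≤ φ 1 := by
      refine le_trans ?_ (Finset.le_sup' _ (Finset.mem_range.2 hs₁))
      simp only [hM, sub_self, one_smul, zero_smul, zero_add]
      rw [div_le_div_iff₀ hβ (hxr s₁ hs₁.le)]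
      linarith
    -- On the segment from a to b, choose the point where the largest M_s is exactly 1/β: the
    -- curvature condition holds with equality somewhere, which also forces a large ratio.
    -- Near-optimality survives by convexity of the losses.
    obtain ⟨l, hl, hφl⟩ := intermediate_value_Icc zero_le_one hφc.continuousOn ⟨h0, h1⟩
    set w := (1 - l) • a + l • b with hw
    have hwm : w ∈ truncSimplex N T :=
      convex_truncSimplex N T ham hbm (by linarith [hl.2]) hl.1 (by ring)
    refine ⟨w, hwm, fun s hs => ?_, fun v hv => ?_, ?_⟩
    · have h : M s w ≤ 1 / β := by
        rw [← hφl]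
        exact Finset.le_sup' (fun s => M s ((1 - l) • a + l • b)) (Finset.mem_range.2 hs)
      rw [hM, div_le_div_iff₀ (hxr s hs.le) hβ] at h
      linarith
    · have ha' := haopt v hv
      have hb' := hbopt v hv
      have hc : ∑ s ∈ Finset.range (m + 1), loss (r s) w ≤
          (1 - l) * ∑ s ∈ Finset.range (m + 1), loss (r s) a +
            l * ∑ s ∈ Finset.range (m + 1), loss (r s) b := by
        rw [Finset.mul_sum, Finset.mul_sum, ← Finset.sum_add_distrib]
        refine Finset.sum_le_sum fun s hs => ?_
        have hs' := (Finset.mem_range.1 hs).le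
        exact loss_combo_le (dotProduct_pos hap (hr s hs')) (dotProduct_pos hbp (hr s hs')) hl.1 hl.2
      have h1' := mul_le_mul_of_nonneg_left ha' (sub_nonneg.2 hl.2)
      have h2' := mul_le_mul_of_nonneg_left hb' hl.1
      have hNL : 0 ≤ N * Real.log T := by positivity
      nlinarith [hl.1, hl.2]
    · obtain ⟨s, hs, hsup⟩ := Finset.exists_mem_eq_sup' (Finset.nonempty_range_add_one (n := m))
        fun s => M s ((1 - l) • a + l • b)
      have hs' := (Finset.mem_range.1 hs).le
      have hMs : M s w = 1 / β := by rw [← hφl]; exact hsup.symm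
      refine ⟨s, hs', exists_ratio_ge (hxp s) (hr s hs') ?_⟩
      rw [← le_div_iff₀ (hxr s hs')]
      change _ ≤ M s w
      rw [hMs]
      exact one_div_le_one_div_of_le hβ (by linarith)

/-- The ratio 1/(8β) turns the gain into 45 N ln T / β, against a cost of 3 N ln T / β; keeping a
surplus of 3 suffices. The final round, outside the comparator's guarantee, costs at most 2 ln T. -/
theorem completed_epoch (hN : 0 < N) (hNT : N < T) {β : ℝ} (hβ : 0 < β) (hβ2 : β ≤ 1 / 2)
    {r x : ℕ → Fin N → ℝ} (hx : x = barrons T β (adaEta N T) r) {n : ℕ} (hn : n ≤ T)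
    (hr : ∀ s ≤ n, (∀ i, 0 ≤ r s i) ∧ ∃ i, 0 < r s i)
    (hprev : ∀ m, n = m + 1 → ENNReal.ofReal β ≤ alpha r x m (regLeader T adaGamma r m))
    (hend : alpha r x n (regLeader T adaGamma r n) < ENNReal.ofReal β) :
    1 / β ≤ 8 * (N * T) ∧ ∀ v ∈ truncSimplex N T,
      ∑ s ∈ Finset.range (n + 1), (loss (r s) (x s) - loss (r s) v) ≤
        8200 * (N ^ 2 * Real.log T ^ 3) - 3 * (N * Real.log T) / β := by
  have hT0 : 0 < T := by omega
  have hN' : (1 : ℝ) ≤ N := by exact_mod_cast hN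
  have hL := log_nat_pos (show 2 ≤ T by omega)
  have hxm : ∀ t, x t ∈ truncSimplex N T := fun t => hx ▸ barrons_mem hN hT0 β _ r t
  obtain ⟨w, hw, hwr, hopt, s, hs, i, hi⟩ := exists_comparator hN hNT hβ hβ2 hxm hr hprev hend
  have hreg := barrons_regret hN hNT hβ hβ2 hx hn (fun s hs => hr s hs.le) hw hwr hs i
  have hxp := truncSimplex_pos hN hT0 (hxm s) i
  refine ⟨?_, fun v hv => ?_⟩
  · have h1 : w i / x s i ≤ N * T := by
      rw [div_le_iff₀ hxp]
      exact truncSimplex_le_mul hN hT0 (hxm s) (truncSimplex_le_one hw) i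
    have h2 : 1 / β = 8 * (1 / (8 * β)) := by field_simp
    linarith
  · have hlast := loss_sub_loss_le_two_log hN hNT (hxm n) hv (hr n le_rfl)
    have hv' := hopt v hv
    rw [Finset.sum_range_succ, Finset.sum_sub_distrib]
    rw [Finset.sum_sub_distrib] at hreg
    have hNL : 0 < N * Real.log T := by positivity
    have h3 := mul_le_mul_of_nonneg_left hi (show 0 ≤ 360 * (N * Real.log T) by positivity)
    have h4 : 360 * (N * Real.log T) * (1 / (8 * β)) = 45 * ((N * Real.log T) / β) := by
      field_simp; norm_num
    have h5 : 3 * (N * Real.log T) / β = 3 * ((N * Real.log T) / β) := by ring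
    have h6 : 0 < (N * Real.log T) / β := by positivity
    have h7 := mul_log_le hN hNT
    have h8 : Real.log T ≤ N * Real.log T := le_mul_of_one_le_left (by linarith) hN'
    linarith

/-- The last leader passed its test, so it satisfies the curvature condition and is itself a valid
comparator. -/
theorem unfinished_epoch (hN : 0 < N) (hNT : N < T) {β : ℝ} (hβ : 0 < β) (hβ2 : β ≤ 1 / 2)
    {r x : ℕ → Fin N → ℝ} (hx : x = barrons T β (adaEta N T) r) {n : ℕ} (hn : n ≤ T)
    (hr : ∀ s < n, (∀ i, 0 ≤ r s i) ∧ ∃ i, 0 < r s i)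
    (hprev : ∀ m, n = m + 1 → ENNReal.ofReal β ≤ alpha r x m (regLeader T adaGamma r m))
    {v : Fin N → ℝ} (hv : v ∈ truncSimplex N T) :
    ∑ s ∈ Finset.range n, (loss (r s) (x s) - loss (r s) v) ≤
      8200 * (N ^ 2 * Real.log T ^ 3) + 3 * (N * Real.log T) / β := by
  have hT0 : 0 < T := by omega
  have hN' : (1 : ℝ) ≤ N := by exact_mod_cast hN
  have hL := log_nat_pos (show 2 ≤ T by omega)
  have hNL : 0 < N * Real.log T := by positivity
  cases n with
  | zero => rw [Finset.sum_range_zero]; positivity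
  | succ m =>
    have hxm : ∀ t, x t ∈ truncSimplex N T := fun t => hx ▸ barrons_mem hN hT0 β _ r t
    have hxp : ∀ s i, 0 < x s i := fun s => truncSimplex_pos hN hT0 (hxm s)
    have hxr : ∀ s ≤ m, 0 < x s ⬝ᵥ r s := fun s hs => dotProduct_pos (hxp s) (hr s (by omega))
    obtain ⟨ham, haopt⟩ := regLeader_spec hN hNT (r := r) (t := m) (fun s hs => hr s (by omega))
    have hal := (ofReal_le_alpha_iff hβ hβ2 hxr).1 (hprev m rfl)
    set a := regLeader T adaGamma r m
    have hwr : ∀ s < m + 1, β * (a ⬝ᵥ r s) ≤ x s ⬝ᵥ r s := fun s hs => by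
      have h := hal s (by omega)
      have h' := mul_le_mul_of_nonneg_left (le_abs_self (a ⬝ᵥ r s / (x s ⬝ᵥ r s) - 1)) hβ.le
      rw [← div_le_one (hxr s (by omega)), mul_div_assoc]
      nlinarith
    -- The play and coordinate are arbitrary: the gain is discarded here.
    have hreg := barrons_regret hN hNT hβ hβ2 hx hn hr ham hwr (Nat.zero_le _) ⟨0, hN⟩
    have hpos := div_pos (truncSimplex_pos hN hT0 ham ⟨0, hN⟩) (hxp 0 ⟨0, hN⟩)
    have h1 : 0 ≤ 360 * (N * Real.log T) * (a ⟨0, hN⟩ / x 0 ⟨0, hN⟩) := by positivity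
    have h2 := haopt v hv
    have h7 := mul_log_le hN hNT
    rw [Finset.sum_sub_distrib] at hreg ⊢
    linarith

/-! ### The epochs of Ada-BARRONS -/

/-- What holds before each round `t` of Ada-BARRONS in state `S`: the regret of the completed epochs is
bounded, with a negative term that pays for the unfinished epoch. -/
theorem adaState_invariant (hN : 0 < N) (hNT : N < T) {r : ℕ → Fin N → ℝ}
    (hr : ∀ t < T, (∀ i, 0 ≤ r t i) ∧ ∃ i, 0 < r t i) (t : ℕ) (ht : t ≤ T) :
    let S := adaState T r t
    S.start + S.round = t ∧ 0 < S.β ∧ S.β ≤ 1 / 2 ∧ 1 / S.β ≤ 16 * (N * T) ∧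
      (∀ s < S.round, adaBarrons T r (S.start + s) = S.epochPlays T r s) ∧
      (∀ m, S.round = m + 1 → ENNReal.ofReal S.β ≤ alpha (S.epochPrices r) (S.epochPlays T r) m
        (regLeader T adaGamma (S.epochPrices r) m)) ∧
      ∃ k : ℕ, 1 / S.β = 2 ^ (k + 1) ∧ ∀ v ∈ truncSimplex N T,
        ∑ s ∈ Finset.range S.start, (loss (r s) (adaBarrons T r s) - loss (r s) v) ≤
          k * (8200 * (N ^ 2 * Real.log T ^ 3)) - 3 * (N * Real.log T) * (1 / S.β - 2) := by
  -- Here k counts completed epochs. They ran with 1/β = 2, 4, …, 2^k, whose sum is 1/β - 2 for the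
  -- current β.
  have hN' : (1 : ℝ) ≤ N := by exact_mod_cast hN
  have hT' : (1 : ℝ) ≤ T := by exact_mod_cast (show 1 ≤ T by omega)
  induction t with
  | zero =>
    refine ⟨rfl, ?_, ?_, ?_, ?_, ?_, 0, ?_, ?_⟩ <;> simp only [adaState]
    · norm_num
    · norm_num
    · norm_num; nlinarith
    · intro s hs; omega
    · intro m hm; omega
    · norm_num
    · intro v _; norm_num
  | succ t ih =>
    obtain ⟨h1, h2, h3, h4, h5, h6, k, h7, h8⟩ := ih (by omega)
    have hplay : adaBarrons T r t =
        (adaState T r t).epochPlays T r (adaState T r t).round := rfl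
    set S := adaState T r t with hS
    have hr' : ∀ s ≤ S.round, (∀ i, 0 ≤ S.epochPrices r s i) ∧ ∃ i, 0 < S.epochPrices r s i :=
      fun s hs => hr (S.start + s) (by omega)
    have hplays : ∀ s ≤ S.round, adaBarrons T r (S.start + s) = S.epochPlays T r s := by
      intro s hs
      rcases hs.lt_or_eq with h | rfl
      · exact h5 s h
      · rw [h1, hplay]
    by_cases hres : S.Restarts T r
    · have hnext : adaState T r (t + 1) = ⟨S.β / 2, S.start + S.round + 1, 0⟩ := by
        rw [adaState, if_pos hres]
      have hhalf : 1 / (S.β / 2) = 2 * (1 / S.β) := by field_simp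
      obtain ⟨he1, he2⟩ := completed_epoch hN hNT h2 h3 (r := S.epochPrices r)
        (x := S.epochPlays T r) rfl (by omega) hr' h6 hres
      rw [hnext]
      refine ⟨?_, ?_, ?_, ?_, ?_, ?_, k + 1, ?_, fun v hv => ?_⟩ <;> dsimp only
      · omega
      · linarith
      · linarith
      · rw [hhalf]; linarith
      · intro s hs; omega
      · intro m hm; omega
      · rw [hhalf, h7]; ring
      · have hsum : ∑ s ∈ Finset.range (S.round + 1),
            (loss (r (S.start + s)) (adaBarrons T r (S.start + s)) - loss (r (S.start + s)) v) =
            ∑ s ∈ Finset.range (S.round + 1), (loss (S.epochPrices r s) (S.epochPlays T r s) -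
              loss (S.epochPrices r s) v) :=
          Finset.sum_congr rfl fun s hs => by
            rw [hplays s (Nat.lt_succ_iff.1 (Finset.mem_range.1 hs))]; rfl
        rw [add_assoc, Finset.sum_range_add, hsum, hhalf]
        have he := he2 v hv
        have h8' := h8 v hv
        have h9 : 3 * (N * Real.log T) / S.β = 3 * (N * Real.log T) * (1 / S.β) := by ring
        push_cast
        linarith
    · have hnext : adaState T r (t + 1) = ⟨S.β, S.start, S.round + 1⟩ := by
        rw [adaState, if_neg hres]
      rw [hnext]
      refine ⟨?_, h2, h3, h4, fun s hs => hplays s (Nat.lt_succ_iff.1 hs), ?_, k, h7, h8⟩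
      · dsimp only; omega
      · intro m hm
        obtain rfl : S.round = m := Nat.succ_injective hm
        exact not_lt.1 hres

theorem adaBarrons_mem (hN : 0 < N) (hT : 0 < T) (r : ℕ → Fin N → ℝ) (t : ℕ) :
    adaBarrons T r t ∈ truncSimplex N T :=
  barrons_mem hN hT _ _ _ _

/-- The regret of Ada-BARRONS against the portfolios in the truncated simplex. -/
theorem adaBarrons_regret_trunc (hN : 0 < N) (hNT : N < T) {r : ℕ → Fin N → ℝ}
    (hr : ∀ t < T, (∀ i, 0 ≤ r t i) ∧ ∃ i, 0 < r t i) {v : Fin N → ℝ}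
    (hv : v ∈ truncSimplex N T) :
    ∑ t ∈ Finset.range T, (loss (r t) (adaBarrons T r t) - loss (r t) v) ≤
      74000 * (N ^ 2 * Real.log T ^ 4) := by
  have hT2 : 2 ≤ T := by omega
  have hN' : (1 : ℝ) ≤ N := by exact_mod_cast hN
  have hT' : (2 : ℝ) ≤ T := by exact_mod_cast hT2
  have hNT' : (N : ℝ) ≤ T := by exact_mod_cast hNT.le
  have hL := log_nat_pos hT2
  obtain ⟨h1, h2, h3, h4, h5, h6, k, h7, h8⟩ := adaState_invariant hN hNT hr T le_rfl
  set S := adaState T r T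
  have hep := unfinished_epoch hN hNT h2 h3 (r := S.epochPrices r) (x := S.epochPlays T r) rfl
    (by omega : S.round ≤ T) (fun s hs => hr (S.start + s) (by omega)) h6 hv
  have hsum : ∑ t ∈ Finset.range T, (loss (r t) (adaBarrons T r t) - loss (r t) v) =
      ∑ s ∈ Finset.range S.start, (loss (r s) (adaBarrons T r s) - loss (r s) v) +
      ∑ s ∈ Finset.range S.round, (loss (S.epochPrices r s) (S.epochPlays T r s) -
        loss (S.epochPrices r s) v) := by
    rw [show Finset.range T = Finset.range (S.start + S.round) by rw [h1], Finset.sum_range_add]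
    congr 1
    refine Finset.sum_congr rfl fun s hs => ?_
    rw [h5 s (Finset.mem_range.1 hs)]; rfl
  -- From 2^(k+1) = 1/β ≤ 16 NT ≤ T⁶ and 6 / ln 2 < 9; the extra 1 accounts for the unfinished
  -- epoch.
  have hk : (k : ℝ) + 1 ≤ 9 * Real.log T := by
    have h : (2 : ℝ) ^ (k + 1) ≤ (T : ℝ) ^ 6 := by
      rw [← h7]
      calc 1 / S.β ≤ 16 * (N * T) := h4
        _ ≤ T ^ 4 * (T * T) := by
            have : (16 : ℝ) ≤ T ^ 4 := by
              calc (16 : ℝ) = 2 ^ 4 := by norm_num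
                _ ≤ T ^ 4 := by gcongr
            gcongr
        _ = T ^ 6 := by ring
    have h' := Real.log_le_log (by positivity) h
    rw [Real.log_pow, Real.log_pow] at h'
    push_cast at h'
    have hk0 : (0 : ℝ) ≤ k := Nat.cast_nonneg k
    nlinarith [Real.log_two_gt_d9]
  have h8' := h8 v hv
  have h9 : 3 * (N * Real.log T) / S.β = 3 * (N * Real.log T) * (1 / S.β) := by ring
  have hNL3 : 0 ≤ 8200 * ((N : ℝ) ^ 2 * Real.log T ^ 3) := by positivity
  have h10 := mul_le_mul_of_nonneg_right hk hNL3
  have h11 : 9 * Real.log T * (8200 * ((N : ℝ) ^ 2 * Real.log T ^ 3)) =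
      73800 * (N ^ 2 * Real.log T ^ 4) := by ring
  have h12 := mul_log_le hN hNT
  have h13 : 0.69 * ((N : ℝ) ^ 2 * Real.log T ^ 3) ≤ N ^ 2 * Real.log T ^ 4 := by
    have : (N : ℝ) ^ 2 * Real.log T ^ 4 = Real.log T * (N ^ 2 * Real.log T ^ 3) := by ring
    rw [this]
    gcongr
  rw [hsum]
  linarith

/-! ### Arbitrary comparators -/

/-- Mixing a portfolio with the uniform one moves it into the truncated simplex, at a small cost. -/
theorem exists_trunc_comparator (hN : 0 < N) (hT : 2 ≤ T) {r : ℕ → Fin N → ℝ}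
    (hr : ∀ t < T, (∀ i, 0 ≤ r t i) ∧ ∃ i, 0 < r t i) {u : Fin N → ℝ}
    (hu : u ∈ stdSimplex ℝ (Fin N)) (hur : ∀ t < T, 0 < u ⬝ᵥ r t) :
    ∃ v ∈ truncSimplex N T,
      ∑ t ∈ Finset.range T, loss (r t) v ≤ ∑ t ∈ Finset.range T, loss (r t) u + 2 := by
  have hN' : (0 : ℝ) < N := by exact_mod_cast hN
  have hT' : (2 : ℝ) ≤ T := by exact_mod_cast hT
  have hc : 0 < 1 - 1 / (T : ℝ) := by
    rw [sub_pos, div_lt_one (by linarith)]; linarith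
  have hv : ((1 - 1 / (T : ℝ)) • u + (1 / (T : ℝ)) • fun _ => 1 / (N : ℝ)) ∈ truncSimplex N T := by
    refine ⟨convex_stdSimplex ℝ (Fin N) hu (uniform_mem_truncSimplex hN (by omega : 0 < T)).1 hc.le
      (by positivity) (by ring), fun i => ?_⟩
    have h1 : 0 ≤ (1 - 1 / (T : ℝ)) * u i := mul_nonneg hc.le (hu.1 i)
    have h2 : 1 / ((N : ℝ) * T) = 1 / T * (1 / N) := by rw [one_div_mul_one_div, mul_comm]
    simp only [Pi.add_apply, Pi.smul_apply, smul_eq_mul]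
    linarith
  refine ⟨_, hv, ?_⟩
  set v := (1 - 1 / (T : ℝ)) • u + (1 / (T : ℝ)) • fun _ => 1 / (N : ℝ) with hvdef
  have hterm : ∀ t ∈ Finset.range T, loss (r t) v ≤ loss (r t) u + 2 / T := by
    intro t ht
    have ht' := Finset.mem_range.1 ht
    have hge : (1 - 1 / (T : ℝ)) * (u ⬝ᵥ r t) ≤ v ⬝ᵥ r t := by
      rw [hvdef, add_dotProduct, smul_dotProduct, smul_dotProduct, smul_eq_mul, smul_eq_mul]
      have : 0 ≤ (fun _ => 1 / (N : ℝ)) ⬝ᵥ r t :=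
        Finset.sum_nonneg fun i _ => mul_nonneg (by positivity) ((hr t ht').1 i)
      have : 0 ≤ 1 / (T : ℝ) * ((fun _ => 1 / (N : ℝ)) ⬝ᵥ r t) := by positivity
      linarith
    have hlog := Real.log_le_log (mul_pos hc (hur t ht')) hge
    rw [Real.log_mul hc.ne' (hur t ht').ne'] at hlog
    have h1 := Real.one_sub_inv_le_log_of_pos hc
    have h2 : (1 - 1 / (T : ℝ))⁻¹ ≤ 1 + 2 / T := by
      rw [inv_le_iff_one_le_mul₀ hc]
      have h3 : (1 + 2 / (T : ℝ)) * (1 - 1 / T) = 1 + 1 / T * (1 - 2 / T) := by ring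
      have h4 : 0 ≤ 1 - 2 / (T : ℝ) := by
        rw [sub_nonneg, div_le_one (by linarith)]; exact hT'
      rw [h3]
      have : 0 ≤ 1 / (T : ℝ) * (1 - 2 / T) := by positivity
      linarith
    unfold loss
    linarith
  calc _ ≤ ∑ t ∈ Finset.range T, (loss (r t) u + 2 / (T : ℝ)) := Finset.sum_le_sum hterm
    _ = _ := by
      rw [Finset.sum_add_distrib, Finset.sum_const, Finset.card_range, nsmul_eq_mul]
      field_simp

theorem sum_extLoss_eq {r x : ℕ → Fin N → ℝ} {n : ℕ} (h : ∀ t < n, 0 < x t ⬝ᵥ r t) :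
    ∑ t ∈ Finset.range n, extLoss (r t) (x t) =
      ((∑ t ∈ Finset.range n, loss (r t) (x t) : ℝ) : EReal) := by
  induction n with
  | zero => simp
  | succ n ih =>
    rw [Finset.sum_range_succ, Finset.sum_range_succ, ih fun t ht => h t (by omega),
      extLoss_eq_loss (h n (by omega)), EReal.coe_add]

theorem extLoss_ne_bot (r x : Fin N → ℝ) : extLoss r x ≠ ⊥ := by
  rw [extLoss, Ne, EReal.neg_eq_bot_iff, ENNReal.log_eq_top_iff]
  exact ENNReal.ofReal_ne_top

theorem sum_extLoss_eq_top {r : ℕ → Fin N → ℝ} {u : Fin N → ℝ} {n t : ℕ} (ht : t < n)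
    (h : u ⬝ᵥ r t = 0) : ∑ s ∈ Finset.range n, extLoss (r s) u = ⊤ := by
  have hne : ∑ s ∈ (Finset.range n).erase t, extLoss (r s) u ≠ ⊥ := by
    refine Finset.sum_induction _ (· ≠ ⊥) (fun a b ha hb => ?_) (by simp) fun s _ =>
      extLoss_ne_bot _ _
    simp [EReal.add_eq_bot_iff, ha, hb]
  rw [← Finset.add_sum_erase _ _ (Finset.mem_range.2 ht), extLoss_eq_top h,
    EReal.top_add_of_ne_bot hne]

theorem adaBarrons_regret_le (hN : 0 < N) (hNT : N < T) {r : ℕ → Fin N → ℝ}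
    (hr : ∀ t < T, (∀ i, 0 ≤ r t i) ∧ ∃ i, 0 < r t i) {u : Fin N → ℝ}
    (hu : u ∈ stdSimplex ℝ (Fin N)) :
    regret T r (adaBarrons T r) u ≤ ((80000 * (N : ℝ) ^ 2 * Real.log T ^ 4 : ℝ) : EReal) := by
  have hT2 : 2 ≤ T := by omega
  have hT0 : 0 < T := by omega
  have hN' : (1 : ℝ) ≤ N := by exact_mod_cast hN
  have hL := log_nat_pos hT2
  have hu0 : ∀ t < T, 0 ≤ u ⬝ᵥ r t := fun t ht =>
    Finset.sum_nonneg fun i _ => mul_nonneg (hu.1 i) ((hr t ht).1 i)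
  rw [regret, sum_extLoss_eq fun t ht =>
    dotProduct_pos (truncSimplex_pos hN hT0 (adaBarrons_mem hN hT0 r t)) (hr t ht)]
  by_cases hur : ∀ t < T, 0 < u ⬝ᵥ r t
  · rw [sum_extLoss_eq (x := fun _ => u) hur, ← EReal.coe_sub, EReal.coe_le_coe_iff]
    obtain ⟨v, hv, hvu⟩ := exists_trunc_comparator hN hT2 hr hu hur
    have h := adaBarrons_regret_trunc hN hNT hr hv
    rw [Finset.sum_sub_distrib] at h
    have h1 : 1 * (0.69 : ℝ) ^ 4 ≤ (N : ℝ) ^ 2 * Real.log T ^ 4 := by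
      have : (1 : ℝ) ≤ (N : ℝ) ^ 2 := one_le_pow₀ hN'
      gcongr
    norm_num at h1
    linarith
  -- A comparator with infinite loss has regret -∞, since the learner's own loss is finite.
  · push Not at hur
    obtain ⟨t, ht, h⟩ := hur
    rw [sum_extLoss_eq_top ht (le_antisymm h (hu0 t ht)), EReal.sub_top]
    · exact bot_le
end

end AdaBarrons

/-- There is an absolute constant `C` such that, for any number `N` of stocks, any horizon `T > N` and any
sequence of nonzero price relative vectors, the regret of Ada-BARRONS against every
constant-rebalanced portfolio `u` is at most `C N² (ln T)⁴`. -/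
theorem theorem2 :
    ∃ C : ℝ, 0 < C ∧
      ∀ (N T : ℕ), 0 < N → N < T →
        ∀ r : ℕ → Fin N → ℝ,
          (∀ t < T, (∀ i, 0 ≤ r t i) ∧ ∃ i, 0 < r t i) →
            ∀ u ∈ stdSimplex ℝ (Fin N),
              AdaBarrons.regret T r (AdaBarrons.adaBarrons T r) u ≤
                ((C * (N : ℝ) ^ 2 * Real.log T ^ 4 : ℝ) : EReal) :=
  ⟨80000, by norm_num, fun _ _ hN hNT _ hr _ hu => AdaBarrons.adaBarrons_regret_le hN hNT hr hu⟩
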